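/- Let $\alpha\in(0,\pi)$ and $N\ge 1$ be fixed. For $\epsilon\in(0,\frac12]$ put $\delta=\epsilon\log\frac1\epsilon$. Let $A_N$ be the set of all $a=(a_1,\dots,a_N)$ with $-1<a_1<\dots<a_N<1$, and for $a\in A_N$ let $$\rho(a)=\tfrac12\min\{2a_1+2,\;a_2-a_1,\dots,a_N-a_{N-1},\;2-2a_N\}.$$ For $a\in A_N$ and $d\in\{\pm1\}^N$, let $M(a,d)$ be the set of all $m=(m_1,m_2)\in W^{1,2}((-1,1);\mathbb S^1)$ (identified with their continuous representatives on $[-1,1]$) such that $m_1(-1)=m_1(1)=\cos\alpha$ and $m_1(a_n)=d_n$ for $n=1,\dots,N$. Let $\mathbb R^2_+=\mathbb R\times(0,\infty)$, let $\dot W^{1,2}(\mathbb R^2)$ be the completion of $C_0^\infty(\mathbb R^2)$ with respect to the norm $\|\nabla\zeta\|_{L^2(\mathbb R^2)}$, and let $\dot W^{1,2}(\mathbb R^2_+)$ be the set of restrictions of its elements to $\mathbb R^2_+$. For $m\in M(a,d)$, let $U(m)\in\dot W^{1,2}(\mathbb R^2_+)$ be the solution, unique up to an additive constant, of $$\int_{\mathbb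 R^2_+}\nabla U(m)\cdot\nabla\zeta\,dx=\int_{-1}^{1}m_1'(x_1)\,\zeta(x_1,0)\,dx_1\qquad\text{for every }\zeta\in C_0^\infty(\mathbb R^2),$$ and define $$E_\epsilon(m)=\frac\epsilon2\int_{-1}^1|m'|^2\,dx_1+\frac12\int_{\mathbb R^2_+}|\nabla U(m)|^2\,dx.$$ Proposition. For every $R\in(0,1]$ there exists a constant $C_0>0$ (depending only on $\alpha$, $N$ and $R$) such that for all $\epsilon\in(0,\frac12]$, all $a\in A_N$ with $\rho(a)\ge R$, and all $d\in\{\pm1\}^N$, $$\inf_{M(a,d)}E_\epsilon\;\le\;\frac{\pi}{2\log\frac1\delta}\sum_{n=1}^N(d_n-\cos\alpha)^2+\frac{C_0}{\left(\log\frac1\delta\right)^2}.$$ -/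

import Mathlib

open MeasureTheory Set
open scoped ContDiff Gradient ENNReal

noncomputable section

namespace NeelWalls

/-- The Euclidean plane. -/
abbrev Plane := EuclideanSpace ℝ (Fin 2)

/-- The open upper half-plane `ℝ × (0, ∞)`. -/
def upperHalfPlane : Set Plane := {x | 0 < x 1}

/-! ### The homogeneous Sobolev space of the plane -/

/-- The vector space of smooth compactly supported functions on the plane. -/
def testSubmodule : Submodule ℝ (Plane → ℝ) where
  carrier := {ζ | ContDiff ℝ ∞ ζ ∧ HasCompactSupport ζ}
  add_mem' := fun hf hg => ⟨hf.1.add hg.1, hf.2.add hg.2⟩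
  zero_mem' := ⟨contDiff_const, HasCompactSupport.zero⟩
  smul_mem' := fun c _ hf => ⟨contDiff_const.smul hf.1, hf.2.smul_left (f := fun _ => c)⟩

/-- The space of test functions, as a type of its own: it is going to carry the norm
`‖∇ ζ‖_{L²}`, and not the topology of pointwise convergence. -/
def TestFun : Type := testSubmodule

instance : AddCommGroup TestFun := inferInstanceAs (AddCommGroup testSubmodule)

instance : Module ℝ TestFun := inferInstanceAs (Module ℝ testSubmodule)

/-- The function underlying a test function. -/
def TestFun.toFun (ζ : TestFun) : Plane → ℝ := (show testSubmodule from ζ).1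

instance : CoeFun TestFun (fun _ => Plane → ℝ) := ⟨TestFun.toFun⟩

theorem TestFun.contDiff (ζ : TestFun) : ContDiff ℝ ∞ ζ := (show testSubmodule from ζ).2.1

theorem TestFun.hasCompactSupport (ζ : TestFun) : HasCompactSupport ζ :=
  (show testSubmodule from ζ).2.2

theorem TestFun.differentiable (ζ : TestFun) : Differentiable ℝ ζ :=
  ζ.contDiff.differentiable (by simp)

theorem TestFun.memLp_gradient (ζ : TestFun) : MemLp (∇ ζ) 2 (volume : Measure Plane) := by
  have hc : Continuous (∇ ζ) := by
    have h := ζ.contDiff.continuous_fderiv (by simp)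
    exact (InnerProductSpace.toDual ℝ Plane).symm.continuous.comp h
  refine hc.memLp_of_hasCompactSupport ?_
  exact (ζ.hasCompactSupport.fderiv (𝕜 := ℝ)).comp_left
    (g := (InnerProductSpace.toDual ℝ Plane).symm) (map_zero _)

/-- The gradient of a test function, as an element of `L²(ℝ²; ℝ²)`. -/
def gradTest : TestFun →ₗ[ℝ] Lp Plane 2 (volume : Measure Plane) where
  toFun ζ := ζ.memLp_gradient.toLp
  map_add' ζ η := by
    rw [← MemLp.toLp_add]
    congr 1
    funext x
    have h : fderiv ℝ (ζ + η).toFun x = fderiv ℝ ζ.toFun x + fderiv ℝ η.toFun x :=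
      fderiv_add (ζ.differentiable x) (η.differentiable x)
    simp [gradient, h]
  map_smul' c ζ := by
    rw [RingHom.id_apply, ← MemLp.toLp_const_smul]
    congr 1
    funext x
    have h : fderiv ℝ (c • ζ).toFun x = c • fderiv ℝ ζ.toFun x :=
      fderiv_const_smul (ζ.differentiable x) c
    simp [gradient, h]

/-- The norm `‖ζ‖ = ‖∇ ζ‖_{L²(ℝ²)}` on the space of test functions. -/
instance : SeminormedAddCommGroup TestFun :=
  SeminormedAddCommGroup.induced TestFun (Lp Plane 2 (volume : Measure Plane)) gradTest

instance : NormedSpace ℝ TestFun :=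
  NormedSpace.induced ℝ TestFun (Lp Plane 2 (volume : Measure Plane)) gradTest

/-- The homogeneous Sobolev space of the plane: the completion of the space of smooth compactly
supported functions with respect to the norm `‖∇ ζ‖_{L²(ℝ²)}`. -/
abbrev HomSobolev : Type := UniformSpace.Completion TestFun

theorem norm_gradTest (ζ : TestFun) : ‖gradTest ζ‖ = ‖ζ‖ := rfl

/-- The gradient of an element of the completion: the continuous extension of the gradient of
test functions. -/
def grad : HomSobolev →L[ℝ] Lp Plane 2 (volume : Measure Plane) :=
  (gradTest.mkContinuous 1 (fun ζ => by rw [norm_gradTest, one_mul])).extend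
    (UniformSpace.Completion.toComplL (𝕜 := ℝ) (E := TestFun))

theorem grad_coe (ζ : TestFun) : grad (ζ : HomSobolev) = gradTest ζ :=
  ContinuousLinearMap.extend_eq _
    (e := UniformSpace.Completion.toComplL (𝕜 := ℝ) (E := TestFun))
    UniformSpace.Completion.denseRange_coe
    (UniformSpace.Completion.isUniformInducing_coe TestFun) ζ

theorem norm_grad (u : HomSobolev) : ‖grad u‖ = ‖u‖ := by
  induction u using UniformSpace.Completion.induction_on with
  | hp => exact isClosed_eq (by fun_prop) (by fun_prop)
  | ih ζ => rw [grad_coe, norm_gradTest, UniformSpace.Completion.norm_coe]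

/-! ### Magnetisations -/

/-- `g` is a weak derivative of `f` in the interval `(-1, 1)`. -/
def IsWeakDeriv (f g : ℝ → Plane) : Prop :=
  LocallyIntegrableOn f (Ioo (-1) 1) ∧ LocallyIntegrableOn g (Ioo (-1) 1) ∧
    ∀ φ : ℝ → ℝ, ContDiff ℝ ∞ φ → HasCompactSupport φ → tsupport φ ⊆ Ioo (-1) 1 →
      ∫ t in Ioo (-1 : ℝ) 1, deriv φ t • f t = -∫ t in Ioo (-1 : ℝ) 1, φ t • g t

open Classical in
/-- The weak derivative in `(-1, 1)`, which is unique almost everywhere there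
(and `0` by convention if there is none). -/
def weakDeriv (f : ℝ → Plane) : ℝ → Plane :=
  if h : ∃ g, IsWeakDeriv f g then h.choose else 0

/-- `m` is (the continuous representative on `[-1, 1]` of) an element of
`W^{1,2}((-1, 1); 𝕊¹)`. The values of `m` outside of `[-1, 1]` play no role. -/
def MemSobolevCircle (m : ℝ → Plane) : Prop :=
  ContinuousOn m (Icc (-1) 1) ∧ (∀ t ∈ Icc (-1 : ℝ) 1, ‖m t‖ = 1) ∧
    ∃ g, IsWeakDeriv m g ∧ MemLp g 2 (volume.restrict (Ioo (-1 : ℝ) 1))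

/-! ### The energy -/

/-- `u` (or rather its restriction to the upper half-plane) is a stray field potential for `m`:
`∫_{ℝ²₊} ∇u · ∇ζ dx = ∫_{-1}^{1} m₁' ζ(·, 0) dx₁` for all `ζ ∈ C₀^∞(ℝ²)`. -/
def IsStrayFieldPotential (m : ℝ → Plane) (u : HomSobolev) : Prop :=
  ∀ ζ : Plane → ℝ, ContDiff ℝ ∞ ζ → HasCompactSupport ζ →
    ∫ x in upperHalfPlane, inner ℝ (grad u x) (∇ ζ x) =
      ∫ t in Ioo (-1 : ℝ) 1, weakDeriv m t 0 * ζ !₂[t, 0]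

/-- The Dirichlet energy `½ ∫_{ℝ²₊} |∇u|² dx`. -/
def halfPlaneDirichlet (u : HomSobolev) : ℝ≥0∞ :=
  2⁻¹ * ∫⁻ x in upperHalfPlane, ‖grad u x‖ₑ ^ 2

theorem measurableSet_upperHalfPlane : MeasurableSet upperHalfPlane :=
  (isOpen_lt continuous_const (by fun_prop)).measurableSet

theorem inner_restrict_eq (f g : Lp Plane 2 (volume : Measure Plane)) :
    inner ℝ ((Lp.memLp f).indicator measurableSet_upperHalfPlane).toLp g =
      ∫ x in upperHalfPlane, inner ℝ (f x) (g x) := by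
  rw [L2.inner_def, ← integral_indicator measurableSet_upperHalfPlane]
  refine integral_congr_ae ?_
  filter_upwards [((Lp.memLp f).indicator measurableSet_upperHalfPlane).coeFn_toLp] with x hx
  rw [hx]
  by_cases h : x ∈ upperHalfPlane <;> simp [h]

theorem isStrayFieldPotential_iff (m : ℝ → Plane) (u : HomSobolev) :
    IsStrayFieldPotential m u ↔ ∀ ζ : TestFun,
      inner ℝ ((Lp.memLp (grad u)).indicator measurableSet_upperHalfPlane).toLp (gradTest ζ) =
        ∫ t in Ioo (-1 : ℝ) 1, weakDeriv m t 0 * ζ !₂[t, 0] := by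
  have key : ∀ ζ : TestFun,
      inner ℝ ((Lp.memLp (grad u)).indicator measurableSet_upperHalfPlane).toLp (gradTest ζ) =
        ∫ x in upperHalfPlane, inner ℝ (grad u x) (∇ ζ x) := by
    intro ζ
    rw [inner_restrict_eq]
    refine integral_congr_ae (ae_restrict_of_ae ?_)
    filter_upwards [ζ.memLp_gradient.coeFn_toLp] with x hx
    exact congrArg _ hx
  constructor
  · intro h ζ
    rw [key]
    exact h ζ ζ.contDiff ζ.hasCompactSupport
  · intro h ζ h1 h2
    let η : TestFun := (⟨ζ, h1, h2⟩ : testSubmodule)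
    exact (key η).symm.trans (h η)

/-- The gradient in the upper half-plane of a stray field potential is unique. -/
theorem grad_ae_eq_of_isStrayFieldPotential {m : ℝ → Plane} {u v : HomSobolev}
    (hu : IsStrayFieldPotential m u) (hv : IsStrayFieldPotential m v) :
    ∀ᵐ x ∂(volume.restrict upperHalfPlane), grad u x = grad v x := by
  rw [isStrayFieldPotential_iff] at hu hv
  set P : HomSobolev → Lp Plane 2 (volume : Measure Plane) := fun w =>
    ((Lp.memLp (grad w)).indicator measurableSet_upperHalfPlane).toLp with hP
  have hsub : P u - P v = P (u - v) := by
    rw [hP]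
    beta_reduce
    rw [← MemLp.toLp_sub]
    refine MemLp.toLp_congr _ _ ?_
    rw [map_sub]
    filter_upwards [Lp.coeFn_sub (grad u) (grad v)] with x hx
    rw [Pi.sub_apply] at hx
    by_cases h : x ∈ upperHalfPlane
    · simp only [Pi.sub_apply, indicator_of_mem h]
      exact hx.symm
    · simp [h]
  have h0 : ∀ w : HomSobolev, inner ℝ (P (u - v)) (grad w) = 0 := by
    intro w
    induction w using UniformSpace.Completion.induction_on with
    | hp => exact isClosed_eq (continuous_const.inner grad.continuous) continuous_const
    | ih ζ => rw [grad_coe, ← hsub, inner_sub_left, hu, hv, sub_self]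
  have h1 := h0 (u - v)
  rw [inner_restrict_eq] at h1
  have hint : Integrable (fun x => inner ℝ (grad (u - v) x) (grad (u - v) x))
      (volume.restrict upperHalfPlane) :=
    (L2.integrable_inner (𝕜 := ℝ) (grad (u - v)) (grad (u - v))).integrableOn
  rw [integral_eq_zero_iff_of_nonneg (fun x => real_inner_self_nonneg) hint] at h1
  rw [map_sub] at h1
  filter_upwards [h1, ae_restrict_of_ae (Lp.coeFn_sub (grad u) (grad v))] with x hx hx'
  have hx2 : (grad u - grad v) x = 0 := inner_self_eq_zero.1 hx
  rw [hx', Pi.sub_apply, sub_eq_zero] at hx2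
  exact hx2

theorem halfPlaneDirichlet_eq_of_isStrayFieldPotential {m : ℝ → Plane} {u v : HomSobolev}
    (hu : IsStrayFieldPotential m u) (hv : IsStrayFieldPotential m v) :
    halfPlaneDirichlet u = halfPlaneDirichlet v := by
  unfold halfPlaneDirichlet
  congr 1
  refine lintegral_congr_ae ?_
  filter_upwards [grad_ae_eq_of_isStrayFieldPotential hu hv] with x hx
  rw [hx]

open Classical in
/-- The magnetostatic energy `½ ∫_{ℝ²₊} |∇U(m)|² dx`, where `U(m)` is the stray field potential
of `m`, which is unique up to a constant (and `∞` by convention if there is none). -/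
def magnetostaticEnergy (m : ℝ → Plane) : ℝ≥0∞ :=
  if h : ∃ u, IsStrayFieldPotential m u then halfPlaneDirichlet h.choose else ∞

/-- The energy `E_ε(m) = (ε / 2) ∫_{-1}^{1} |m'|² dx₁ + ½ ∫_{ℝ²₊} |∇U(m)|² dx`. -/
def energy (ε : ℝ) (m : ℝ → Plane) : ℝ≥0∞ :=
  ENNReal.ofReal (ε / 2) * (∫⁻ t in Ioo (-1 : ℝ) 1, ‖weakDeriv m t‖ₑ ^ 2) + magnetostaticEnergy m

/-! ### Configurations of walls -/

/-- The set `A_N` of all `a = (a₁, …, a_N)` with `-1 < a₁ < ⋯ < a_N < 1`. -/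
def wallPositions (N : ℕ) : Set (Fin N → ℝ) :=
  {a | StrictMono a ∧ ∀ n, a n ∈ Ioo (-1 : ℝ) 1}

/-- `ρ(a) = ½ min {2 a₁ + 2, a₂ - a₁, …, a_N - a_{N-1}, 2 - 2 a_N}`. The index `0` is the first
one, and `Fin.rev 0` is the last one. -/
def rho {N : ℕ} [NeZero N] (a : Fin N → ℝ) : ℝ :=
  sInf ({2 * a 0 + 2, 2 - 2 * a (Fin.rev 0)} ∪
    {t | ∃ i j : Fin N, (i : ℕ) + 1 = j ∧ t = a j - a i}) / 2

/-- The set `M(a, d)` of all `m ∈ W^{1,2}((-1, 1); 𝕊¹)` with `m₁(-1) = m₁(1) = cos α` and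
`m₁(a_n) = d_n` for all `n`. -/
def admissible (α : ℝ) {N : ℕ} (a d : Fin N → ℝ) : Set (ℝ → Plane) :=
  {m | MemSobolevCircle m ∧ m (-1) 0 = Real.cos α ∧ m 1 0 = Real.cos α ∧ ∀ n, m (a n) 0 = d n}

/-- The core width `δ = ε log (1 / ε)`. -/
def coreWidth (ε : ℝ) : ℝ := ε * Real.log (1 / ε)

end NeelWalls

end

namespace NeelWalls

/-! ### Weak derivatives -/

/-! The infimum is bounded by the energy of one explicit competitor, `trial`. Around each wall its
first component is a truncated logarithm, `c + (d n - c) * wallProfile R δ (t - a n)` with `c = cos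
α`, and its second component is the nonnegative root making the vector unit. Since `R ≤ ρ(a)`, the
tails of different walls do not overlap and stay inside `[-1, 1]`. Write `L = wallLog R δ = log (1 +
R² / δ²)`.

Exchange energy: on the circle `|m'|² = m₁'² / (1 - m₁²)`. The degeneracy of the denominator at a
wall is absorbed by `wallSlope_sq_le` and `one_sub_sq_mul_le`, leaving a sum of Cauchy densities `1
/ ((t - a n)² + δ²)` of size `1 / L`, each of integral `π / δ`. As `ε / δ = 1 / log (1 / ε)`, the
contribution is of order `1 / (log (1 / δ))²`.

Stray field energy: by duality it is at most `M² / 4` if `|2 ∫ m₁' ζ(·, 0)| ≤ M ‖∇ζ‖` for all test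
functions (`exists_isStrayFieldPotential`). The slope of the profile is odd about each wall, so only
differences `ζ(a + r, 0) - ζ(a - r, 0)` enter, and these are estimated along both half circles of
radius `r` (`two_mul_abs_sub_le`). Cauchy–Schwarz on disjoint discs then gives `M² = 4π / L * ∑ (d n
- c)²` (`abs_two_mul_integral_sum_le`, `lintegral_mul_wallSlope_sq_le`).

The energy is thus at most `π / L * ∑ (d n - c)²` plus the exchange term, and `L ≥ 2 log (1 / δ) - 2
log (1 / R)` turns this into the claimed leading term with an error of second order. -/

theorem integrableOn_smul_of_locallyIntegrableOn {g : ℝ → Plane} {U : Set ℝ}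
    (hg : LocallyIntegrableOn g U) {φ : ℝ → ℝ} (hφ : Continuous φ)
    (hc : HasCompactSupport φ) (hs : tsupport φ ⊆ U) :
    Integrable (fun t => φ t • g t) (volume.restrict U) := by
  have h1 : IntegrableOn (fun t => φ t • g t) (tsupport φ) :=
    (hg.integrableOn_compact_subset hs hc).continuousOn_smul hφ.continuousOn hc
  refine IntegrableOn.integrable_of_forall_notMem_eq_zero h1 (fun t ht => ?_) |>.integrableOn
  rw [image_eq_zero_of_notMem_tsupport ht, zero_smul]

theorem IsWeakDeriv.ae_eq {f g g' : ℝ → Plane} (h : IsWeakDeriv f g) (h' : IsWeakDeriv f g') :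
    ∀ᵐ t ∂(volume.restrict (Ioo (-1 : ℝ) 1)), g t = g' t := by
  rw [ae_restrict_iff' measurableSet_Ioo]
  have := isOpen_Ioo.ae_eq_zero_of_integral_contDiff_smul_eq_zero (h.2.1.sub h'.2.1) (μ := volume)
    (fun φ h1 h2 h3 => by
      rw [← setIntegral_eq_integral_of_forall_compl_eq_zero (s := Ioo (-1 : ℝ) 1)]
      · simp only [Pi.sub_apply, smul_sub]
        rw [integral_sub (integrableOn_smul_of_locallyIntegrableOn h.2.1 h1.continuous h2 h3)
          (integrableOn_smul_of_locallyIntegrableOn h'.2.1 h1.continuous h2 h3), sub_eq_zero,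
          ← neg_inj, ← h.2.2 φ h1 h2 h3, ← h'.2.2 φ h1 h2 h3]
      · intro x hx
        rw [image_eq_zero_of_notMem_tsupport (fun hh => hx (h3 hh)), zero_smul])
  filter_upwards [this] with t ht hm
  exact sub_eq_zero.1 (ht hm)

/-- `weakDeriv` is an arbitrary choice; almost everywhere uniqueness lets an explicit derivative
replace it in the energy. -/
theorem IsWeakDeriv.ae_eq_weakDeriv {f g : ℝ → Plane} (h : IsWeakDeriv f g) :
    ∀ᵐ t ∂(volume.restrict (Ioo (-1 : ℝ) 1)), weakDeriv f t = g t := by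
  have hex : ∃ g, IsWeakDeriv f g := ⟨g, h⟩
  rw [weakDeriv, dif_pos hex]
  exact hex.choose_spec.ae_eq h

/-- A continuous function which is differentiable off a countable set, with integrable derivative,
is weakly differentiable. -/
theorem isWeakDeriv_of_hasDerivAt {f g : ℝ → Plane} {s : Set ℝ} (hs : s.Countable)
    (hf : Continuous f) (hd : ∀ t ∉ s, HasDerivAt f (g t) t)
    (hg : IntegrableOn g (Icc (-1) 1)) : IsWeakDeriv f g := by
  refine ⟨hf.locallyIntegrable.locallyIntegrableOn _,
    (hg.mono_set Ioo_subset_Icc_self).locallyIntegrableOn, fun φ h1 h2 h3 => ?_⟩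
  have hi1 : IntegrableOn (fun t => φ t • g t) (Icc (-1 : ℝ) 1) :=
    hg.continuousOn_smul h1.continuous.continuousOn isCompact_Icc
  have hi2 : IntegrableOn (fun t => deriv φ t • f t) (Icc (-1 : ℝ) 1) :=
    (((h1.continuous_deriv (by simp)).smul hf).continuousOn).integrableOn_compact isCompact_Icc
  -- The fundamental theorem for `φ • f` tolerates a countable exceptional set; the boundary terms
  -- vanish because `φ` is supported in the open interval.
  have key := integral_eq_of_hasDerivAt_off_countable_of_le (fun t => φ t • f t)
    (fun t => φ t • g t + deriv φ t • f t) (a := -1) (b := 1) (by norm_num) hs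
    (h1.continuous.smul hf).continuousOn
    (fun t ht => ((h1.differentiable (by simp)) t).hasDerivAt.smul (hd t ht.2))
    (by
      rw [intervalIntegrable_iff_integrableOn_Icc_of_le (by norm_num)]
      exact hi1.add hi2)
  have e1 : φ 1 = 0 := image_eq_zero_of_notMem_tsupport fun h => by simpa using h3 h
  have e2 : φ (-1) = 0 := image_eq_zero_of_notMem_tsupport fun h => by simpa using h3 h
  rw [intervalIntegral.integral_of_le (by norm_num), integral_Ioc_eq_integral_Ioo, e1, e2,
    zero_smul, zero_smul, sub_zero, integral_add (hi1.mono_set Ioo_subset_Icc_self)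
      (hi2.mono_set Ioo_subset_Icc_self)] at key
  exact eq_neg_of_add_eq_zero_right key

/-! ### Reflection in the horizontal axis -/

/-- The reflection `(x₁, x₂) ↦ (x₁, -x₂)`. -/
noncomputable def reflect : Plane ≃ₗᵢ[ℝ] Plane :=
  LinearIsometryEquiv.piLpCongrRight 2
    (fun i : Fin 2 => if i = 1 then LinearIsometryEquiv.neg ℝ else LinearIsometryEquiv.refl ℝ ℝ)

theorem reflect_apply_zero (x : Plane) : reflect x 0 = x 0 := by
  simp [reflect]

theorem reflect_apply_one (x : Plane) : reflect x 1 = -x 1 := by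
  simp [reflect]

theorem gradient_reflect {f : Plane → ℝ} (hf : Differentiable ℝ f)
    (he : ∀ x, f (reflect x) = f x) (x : Plane) : ∇ f x = reflect.symm (∇ f (reflect x)) := by
  have h1 : f = f ∘ reflect := funext fun x => (he x).symm
  have h2 : fderiv ℝ f x = (fderiv ℝ f (reflect x)).comp
      (reflect.toContinuousLinearEquiv : Plane →L[ℝ] Plane) := by
    conv_lhs => rw [h1]
    exact ((hf (reflect x)).hasFDerivAt.comp x
      (reflect.toContinuousLinearEquiv : Plane →L[ℝ] Plane).hasFDerivAt).fderiv
  refine ext_inner_right ℝ fun v => ?_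
  rw [reflect.symm.inner_map_eq_flip, LinearIsometryEquiv.symm_symm, gradient, gradient,
    InnerProductSpace.toDual_symm_apply, InnerProductSpace.toDual_symm_apply, h2]
  rfl

theorem volume_horizontal_axis : volume {x : Plane | x 1 = 0} = 0 := by
  have h := Measure.addHaar_submodule (volume : Measure Plane)
    (LinearMap.ker (EuclideanSpace.proj (𝕜 := ℝ) (1 : Fin 2) : Plane →L[ℝ] ℝ).toLinearMap) (by
      intro h
      have : (!₂[0, 1] : Plane) ∈ (⊤ : Submodule ℝ Plane) := trivial
      rw [← h] at this
      simp at this)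
  have e : {x : Plane | x 1 = 0} = (LinearMap.ker
      (EuclideanSpace.proj (𝕜 := ℝ) (1 : Fin 2) : Plane →L[ℝ] ℝ).toLinearMap : Set Plane) := by
    ext x
    simp
  rw [e]
  exact h

/-- The complement of the half-plane is its mirror image up to the horizontal axis, a null set, so
both halves contribute equally. -/
theorem setIntegral_upperHalfPlane_of_even {q : Plane → ℝ} (hq : ∀ x, q (reflect x) = q x)
    (hi : Integrable q) : ∫ x in upperHalfPlane, q x = 2⁻¹ * ∫ x, q x := by
  have h1 := integral_add_compl measurableSet_upperHalfPlane hi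
  have h2 : ∫ x in upperHalfPlaneᶜ, q x = ∫ x in reflect ⁻¹' upperHalfPlane, q x := by
    refine setIntegral_congr_set ?_
    have h0 : ∀ᵐ x : Plane, x 1 ≠ 0 := by
      rw [ae_iff]; simpa using volume_horizontal_axis
    filter_upwards [h0] with x hx
    refine propext ?_
    change ¬ (0 < x 1) ↔ 0 < reflect x 1
    rw [reflect_apply_one]
    constructor
    · intro h; have := lt_of_le_of_ne (not_lt.1 h) hx; linarith
    · intro h; linarith
  have h3 := reflect.measurePreserving.setIntegral_preimage_emb
    reflect.toHomeomorph.measurableEmbedding q upperHalfPlane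
  simp only [hq] at h3
  rw [h2, h3] at h1
  linarith

/-- The test functions which are even in the second variable. -/
def evenTest : Submodule ℝ TestFun where
  carrier := {ζ | ∀ x, ζ (reflect x) = ζ x}
  add_mem' {ζ η} hf hg x := by
    change ζ (reflect x) + η (reflect x) = ζ x + η x
    rw [hf x, hg x]
  zero_mem' x := rfl
  smul_mem' c ζ hf x := by
    change c * ζ (reflect x) = c * ζ x
    rw [hf x]

/-- The restriction of a square integrable field to the upper half-plane. -/
noncomputable def upperPart (f : Lp Plane 2 (volume : Measure Plane)) :
    Lp Plane 2 (volume : Measure Plane) :=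
  ((Lp.memLp f).indicator measurableSet_upperHalfPlane).toLp

theorem inner_upperPart_comm (f g : Lp Plane 2 (volume : Measure Plane)) :
    inner ℝ (upperPart f) g = inner ℝ (upperPart g) f := by
  rw [upperPart, upperPart, inner_restrict_eq, inner_restrict_eq]
  simp only [real_inner_comm]

theorem inner_upperPart_gradTest_of_even {ζ η : TestFun} (hζ : ζ ∈ evenTest) (hη : η ∈ evenTest) :
    inner ℝ (upperPart (gradTest ζ)) (gradTest η) = 2⁻¹ * inner ℝ (gradTest ζ) (gradTest η) := by
  have e : ∀ᵐ x, inner ℝ (gradTest ζ x) (gradTest η x) = inner ℝ (∇ ζ x) (∇ η x) := by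
    filter_upwards [ζ.memLp_gradient.coeFn_toLp, η.memLp_gradient.coeFn_toLp] with x h1 h2
    exact congrArg₂ _ h1 h2
  have hi := (integrable_congr e).1 (L2.integrable_inner (𝕜 := ℝ) (gradTest ζ) (gradTest η))
  rw [upperPart, inner_restrict_eq, L2.inner_def, integral_congr_ae e,
    integral_congr_ae (ae_restrict_of_ae e)]
  refine setIntegral_upperHalfPlane_of_even (fun x => ?_) hi
  rw [gradient_reflect ζ.differentiable hζ x, gradient_reflect η.differentiable hη x,
    LinearIsometryEquiv.inner_map_map]

/-- The closure in `L²` of the gradients of the even test functions. -/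
noncomputable def evenGradients : Submodule ℝ (Lp Plane 2 (volume : Measure Plane)) :=
  (evenTest.map gradTest).topologicalClosure

/-- Both sides are continuous in each argument, so the identity passes from gradients of even test
functions to their closure, one argument at a time. The factor `½` converts a Riesz representation
on the plane into the weak equation on the half-plane. -/
theorem inner_upperPart_of_mem_evenGradients {f g : Lp Plane 2 (volume : Measure Plane)}
    (hf : f ∈ evenGradients) (hg : g ∈ evenGradients) :
    inner ℝ (upperPart f) g = 2⁻¹ * inner ℝ f g := by
  have hg' := hg
  have h1 : ∀ ζ ∈ evenTest, ∀ g ∈ evenGradients,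
      inner ℝ (upperPart (gradTest ζ)) g = 2⁻¹ * inner ℝ (gradTest ζ) g := by
    intro ζ hζ g hg
    change g ∈ closure (evenTest.map gradTest : Set _) at hg
    refine closure_minimal (s := (evenTest.map gradTest : Set _)) (t := {g |
      inner ℝ (upperPart (gradTest ζ)) g = 2⁻¹ * inner ℝ (gradTest ζ) g}) ?_ ?_ hg
    · rintro _ ⟨η, hη, rfl⟩
      exact inner_upperPart_gradTest_of_even hζ hη
    · exact isClosed_eq (by fun_prop) (by fun_prop)
  change f ∈ closure (evenTest.map gradTest : Set _) at hf
  refine closure_minimal (s := (evenTest.map gradTest : Set _)) (t := {f |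
    inner ℝ (upperPart f) g = 2⁻¹ * inner ℝ f g}) ?_ ?_ hf
  · rintro _ ⟨η, hη, rfl⟩
    exact h1 η hη g hg'
  · simp only [inner_upperPart_comm _ g]
    exact isClosed_eq (by fun_prop) (by fun_prop)

/-! ### Riesz representation in the homogeneous Sobolev space -/

/-- Riesz representation is applied inside the closed subspace `evenGradients`, so the representing
field is automatically even. It is a genuine gradient because `grad` is an isometry from a complete
space: its range is closed and hence contains `evenGradients`. -/
theorem exists_grad_mem_evenGradients (F : TestFun →ₗ[ℝ] ℝ) (M : ℝ) (hM : 0 ≤ M)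
    (hF : ∀ ζ, |F ζ| ≤ M * ‖ζ‖) :
    ∃ u : HomSobolev, grad u ∈ evenGradients ∧ ‖grad u‖ ≤ M ∧
      ∀ ζ ∈ evenTest, inner ℝ (grad u) (gradTest ζ) = F ζ := by
  let G : HomSobolev →L[ℝ] ℝ := (F.mkContinuous M hF).extend
    (UniformSpace.Completion.toComplL (𝕜 := ℝ) (E := TestFun))
  have hG : ∀ ζ : TestFun, G (ζ : HomSobolev) = F ζ := fun ζ =>
    ContinuousLinearMap.extend_eq _
      (e := UniformSpace.Completion.toComplL (𝕜 := ℝ) (E := TestFun))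
      UniformSpace.Completion.denseRange_coe
      (UniformSpace.Completion.isUniformInducing_coe TestFun) ζ
  have hGn : ∀ u, |G u| ≤ M * ‖u‖ := by
    intro u
    induction u using UniformSpace.Completion.induction_on with
    | hp => exact isClosed_le (by fun_prop) (by fun_prop)
    | ih ζ => rw [hG, UniformSpace.Completion.norm_coe]; exact hF ζ
  let I : HomSobolev →ₗᵢ[ℝ] Lp Plane 2 (volume : Measure Plane) :=
    ⟨grad.toLinearMap, norm_grad⟩
  let K : Submodule ℝ (Lp Plane 2 (volume : Measure Plane)) := LinearMap.range I.toLinearMap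
  have hKc : IsClosed (K : Set (Lp Plane 2 (volume : Measure Plane))) := by
    have := I.isometry.isClosedEmbedding.isClosed_range
    exact this
  have hle : evenGradients ≤ K := by
    refine closure_minimal ?_ hKc
    rintro _ ⟨ζ, -, rfl⟩
    exact ⟨(ζ : HomSobolev), grad_coe ζ⟩
  have : CompleteSpace evenGradients :=
    (Submodule.isClosed_topologicalClosure _).completeSpace_coe
  let e := I.equivRange
  let L : evenGradients →L[ℝ] ℝ := (G.comp e.symm.toContinuousLinearEquiv.toContinuousLinearMap).comp
    (evenGradients.subtypeL.codRestrict K fun x => hle x.2)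
  have hLn : ‖L‖ ≤ M := by
    refine L.opNorm_le_bound hM fun v => ?_
    refine (hGn _).trans_eq ?_
    congr 1
    exact e.symm.norm_map _
  let w := (InnerProductSpace.toDual ℝ evenGradients).symm L
  obtain ⟨u, hu⟩ := hle w.2
  have hu' : grad u = w := hu
  refine ⟨u, hu' ▸ w.2, ?_, fun ζ hζ => ?_⟩
  · rw [hu', ← Submodule.coe_norm, LinearIsometryEquiv.norm_map]; exact hLn
  · have hm : gradTest ζ ∈ evenGradients :=
      Submodule.le_topologicalClosure _ ⟨ζ, hζ, rfl⟩
    have := InnerProductSpace.toDual_symm_apply (𝕜 := ℝ) (x := (⟨gradTest ζ, hm⟩ : evenGradients))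
      (y := L)
    rw [hu']
    refine this.trans ?_
    change G (e.symm ⟨gradTest ζ, _⟩) = _
    rw [← hG ζ]
    congr 1
    rw [LinearIsometryEquiv.symm_apply_eq]
    exact Subtype.ext (grad_coe ζ).symm

/-! ### Smooth even approximations of a test function in the upper half-plane -/

/-- The second unit vector. -/
noncomputable def vertical : Plane := EuclideanSpace.single 1 1

theorem norm_vertical : ‖vertical‖ = 1 := by simp [vertical]

/-- The smooth even map `(x₁, x₂) ↦ (x₁, √(x₂² + η²))`. -/
noncomputable def fold (η : ℝ) (x : Plane) : Plane :=
  x + (Real.sqrt (x 1 ^ 2 + η ^ 2) - x 1) • vertical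

theorem fold_apply_zero (η : ℝ) (x : Plane) : fold η x 0 = x 0 := by simp [fold, vertical]

theorem fold_apply_one (η : ℝ) (x : Plane) : fold η x 1 = Real.sqrt (x 1 ^ 2 + η ^ 2) := by
  simp [fold, vertical]

theorem fold_reflect (η : ℝ) (x : Plane) : fold η (reflect x) = fold η x := by
  ext i
  fin_cases i
  · simp [fold_apply_zero, reflect_apply_zero]
  · simp [fold_apply_one, reflect_apply_one]

/-- Folding never moves a point closer to the origin, so composing with `fold η` keeps the support
inside the same ball, uniformly in `η`. -/
theorem norm_le_norm_fold (η : ℝ) (x : Plane) : ‖x‖ ≤ ‖fold η x‖ := by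
  rw [EuclideanSpace.norm_eq, EuclideanSpace.norm_eq]
  refine Real.sqrt_le_sqrt ?_
  simp only [Fin.sum_univ_two, fold_apply_zero, fold_apply_one, Real.norm_eq_abs, sq_abs]
  rw [Real.sq_sqrt (by positivity)]
  nlinarith [sq_nonneg η]

theorem contDiff_coord (i : Fin 2) : ContDiff ℝ ∞ (fun x : Plane => x i) :=
  (EuclideanSpace.proj (𝕜 := ℝ) i : Plane →L[ℝ] ℝ).contDiff

theorem contDiff_fold {η : ℝ} (hη : 0 < η) : ContDiff ℝ ∞ (fold η) := by
  have h : ContDiff ℝ ∞ (fun x : Plane => Real.sqrt (x 1 ^ 2 + η ^ 2)) :=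
    (((contDiff_coord 1).pow 2).add contDiff_const).sqrt (fun x => by positivity)
  exact contDiff_id.add ((h.sub (contDiff_coord 1)).smul contDiff_const)

theorem hasFDerivAt_fold {η : ℝ} (hη : 0 < η) (x : Plane) :
    HasFDerivAt (fold η) (ContinuousLinearMap.id ℝ Plane +
      (x 1 / Real.sqrt (x 1 ^ 2 + η ^ 2) - 1) •
        (EuclideanSpace.proj (𝕜 := ℝ) (1 : Fin 2) : Plane →L[ℝ] ℝ).smulRight vertical) x := by
  have hp : HasFDerivAt (fun x : Plane => x 1)
    (EuclideanSpace.proj (𝕜 := ℝ) (1 : Fin 2) : Plane →L[ℝ] ℝ) x :=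
    (EuclideanSpace.proj (𝕜 := ℝ) (1 : Fin 2) : Plane →L[ℝ] ℝ).hasFDerivAt
  have h := (((hp.pow 2).add_const (η ^ 2)).sqrt (by positivity)).sub hp
  have h2 := (hasFDerivAt_id x).add (h.smul_const vertical)
  refine h2.congr_fderiv ?_
  ext v i
  have : Real.sqrt (x 1 ^ 2 + η ^ 2) ≠ 0 := (Real.sqrt_pos.2 (by positivity)).ne'
  simp
  field_simp

theorem abs_div_sqrt_sub_one_le (η s : ℝ) : |s / Real.sqrt (s ^ 2 + η ^ 2) - 1| ≤ 2 := by
  have h1 : |s / Real.sqrt (s ^ 2 + η ^ 2)| ≤ 1 := by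
    rw [abs_div, abs_of_nonneg (Real.sqrt_nonneg _)]
    refine div_le_one_of_le₀ (Real.abs_le_sqrt ?_) (Real.sqrt_nonneg _)
    nlinarith [sq_nonneg η]
  rw [abs_le] at h1 ⊢
  constructor <;> linarith [h1.1, h1.2]

/-- The composition of a test function with `fold η`. -/
noncomputable def foldTest (ζ : TestFun) (η : ℝ) (hη : 0 < η) : TestFun :=
  (⟨fun x => ζ (fold η x), ζ.contDiff.comp (contDiff_fold hη), by
    obtain ⟨r, hr⟩ := ζ.hasCompactSupport.isBounded.subset_closedBall 0
    refine HasCompactSupport.of_support_subset_isCompact (isCompact_closedBall (0 : Plane) r) ?_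
    intro x hx
    have := hr (subset_tsupport _ hx)
    rw [mem_closedBall_zero_iff] at this ⊢
    exact (norm_le_norm_fold η x).trans this⟩ : testSubmodule)

theorem foldTest_apply (ζ : TestFun) {η : ℝ} (hη : 0 < η) (x : Plane) :
    foldTest ζ η hη x = ζ (fold η x) := rfl

theorem foldTest_mem_evenTest (ζ : TestFun) {η : ℝ} (hη : 0 < η) : foldTest ζ η hη ∈ evenTest :=
  fun x => by rw [foldTest_apply, foldTest_apply, fold_reflect]

theorem inner_gradient (f : Plane → ℝ) (x w : Plane) : inner ℝ w (∇ f x) = fderiv ℝ f x w := by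
  rw [real_inner_comm, gradient, InnerProductSpace.toDual_symm_apply]

theorem inner_gradient_foldTest (ζ : TestFun) {η : ℝ} (hη : 0 < η) (x w : Plane) :
    inner ℝ w (∇ (foldTest ζ η hη) x) = fderiv ℝ ζ (fold η x)
      (w + (x 1 / Real.sqrt (x 1 ^ 2 + η ^ 2) - 1) • w 1 • vertical) := by
  have h : HasFDerivAt (foldTest ζ η hη) _ x :=
    (ζ.differentiable (fold η x)).hasFDerivAt.comp x (hasFDerivAt_fold hη x)
  rw [inner_gradient, h.fderiv]
  simp

theorem TestFun.exists_fderiv_bound (ζ : TestFun) :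
    ∃ C r : ℝ, 0 ≤ C ∧ ∀ x, ‖fderiv ℝ ζ x‖ ≤ C ∧ (r < ‖x‖ → fderiv ℝ ζ x = 0) := by
  have hs : HasCompactSupport (fderiv ℝ ζ) := ζ.hasCompactSupport.fderiv (𝕜 := ℝ)
  obtain ⟨C, hC⟩ := hs.exists_bound_of_continuous (ζ.contDiff.continuous_fderiv (by simp))
  obtain ⟨r, hr⟩ := hs.isBounded.subset_closedBall 0
  refine ⟨C, r, (norm_nonneg _).trans (hC 0), fun x => ⟨hC x, fun hx => ?_⟩⟩
  refine image_eq_zero_of_notMem_tsupport fun h => ?_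
  have := hr h
  rw [mem_closedBall_zero_iff] at this
  linarith

theorem tendsto_fold {η : ℕ → ℝ} (hη : Filter.Tendsto η Filter.atTop (nhds 0)) {x : Plane}
    (hx : 0 ≤ x 1) : Filter.Tendsto (fun n => fold (η n) x) Filter.atTop (nhds x) := by
  have hc : Continuous fun η : ℝ => fold η x := by unfold fold; fun_prop
  have h := (hc.tendsto 0).comp hη
  have e : fold 0 x = x := by
    simp [fold, Real.sqrt_sq hx]
  rwa [e] at h

theorem continuous_gradient_testFun (ζ : TestFun) : Continuous (∇ ζ) :=
  (InnerProductSpace.toDual ℝ Plane).symm.continuous.comp (ζ.contDiff.continuous_fderiv (by simp))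

/-- On the upper half-plane `fold η` and its derivative converge to the identity map and its
derivative as `η → 0`; dominated convergence does the rest. -/
theorem tendsto_setIntegral_inner_gradient_foldTest (ζ : TestFun)
    (f : Lp Plane 2 (volume : Measure Plane)) {η : ℕ → ℝ} (hpos : ∀ n, 0 < η n)
    (hη : Filter.Tendsto η Filter.atTop (nhds 0)) :
    Filter.Tendsto
      (fun n => ∫ x in upperHalfPlane, inner ℝ (f x) (∇ (foldTest ζ (η n) (hpos n)) x))
      Filter.atTop (nhds (∫ x in upperHalfPlane, inner ℝ (f x) (∇ ζ x))) := by
  obtain ⟨C, r, hC0, hC⟩ := ζ.exists_fderiv_bound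
  have hfm := (Lp.memLp f).1
  -- The constant 3 is 1 for the identity part of the derivative of `fold` plus 2 from
  -- `abs_div_sqrt_sub_one_le`.
  have hball : IntegrableOn (fun x => 3 * C * ‖f x‖) (Metric.closedBall (0 : Plane) r) := by
    refine Integrable.const_mul (Integrable.norm ?_) _
    have : IsFiniteMeasure (volume.restrict (Metric.closedBall (0 : Plane) r)) :=
      ⟨by simpa using (isCompact_closedBall (0 : Plane) r).measure_lt_top (μ := volume)⟩
    exact ((Lp.memLp f).restrict _).integrable (by norm_num)
  refine tendsto_integral_of_dominated_convergence
    ((Metric.closedBall (0 : Plane) r).indicator fun x => 3 * C * ‖f x‖) ?_ ?_ ?_ ?_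
  · exact fun n => (hfm.inner (continuous_gradient_testFun _).aestronglyMeasurable).restrict
  · exact (hball.integrable_indicator measurableSet_closedBall).integrableOn
  · intro n
    refine Filter.Eventually.of_forall fun x => ?_
    rw [inner_gradient_foldTest, Real.norm_eq_abs, ← Real.norm_eq_abs]
    by_cases hx : x ∈ Metric.closedBall (0 : Plane) r
    · rw [indicator_of_mem hx]
      refine (ContinuousLinearMap.le_opNorm _ _).trans ?_
      have h1 : ‖(x 1 / Real.sqrt (x 1 ^ 2 + η n ^ 2) - 1) • (f x) 1 • vertical‖ ≤ 2 * ‖f x‖ := by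
        rw [norm_smul, norm_smul, norm_vertical, mul_one]
        exact mul_le_mul (abs_div_sqrt_sub_one_le _ _) (PiLp.norm_apply_le _ _) (norm_nonneg _)
          (by norm_num)
      have h2 := norm_add_le (f x) ((x 1 / Real.sqrt (x 1 ^ 2 + η n ^ 2) - 1) • (f x) 1 • vertical)
      calc _ ≤ C * (3 * ‖f x‖) :=
            mul_le_mul (hC _).1 (by linarith) (norm_nonneg _) hC0
        _ = _ := by ring
    · rw [indicator_of_notMem hx, (hC _).2, zero_apply, norm_zero]
      rw [mem_closedBall_zero_iff, not_le] at hx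
      exact hx.trans_le (norm_le_norm_fold _ _)
  · filter_upwards [ae_restrict_mem measurableSet_upperHalfPlane] with x hx
    have hx : 0 < x 1 := hx
    simp only [inner_gradient_foldTest]
    rw [inner_gradient]
    have h1 : Filter.Tendsto (fun n => fderiv ℝ ζ (fold (η n) x)) Filter.atTop
        (nhds (fderiv ℝ ζ x)) :=
      ((ζ.contDiff.continuous_fderiv (by simp)).tendsto x).comp (tendsto_fold hη hx.le)
    have h2 : Filter.Tendsto (fun n => f x +
        (x 1 / Real.sqrt (x 1 ^ 2 + η n ^ 2) - 1) • (f x) 1 • vertical) Filter.atTop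
        (nhds (f x)) := by
      have hc : ContinuousAt (fun s : ℝ => f x +
          (x 1 / Real.sqrt (x 1 ^ 2 + s ^ 2) - 1) • (f x) 1 • vertical) 0 := by
        have : Real.sqrt (x 1 ^ 2 + 0 ^ 2) ≠ 0 := (Real.sqrt_pos.2 (by positivity)).ne'
        fun_prop (disch := assumption)
      have h := hc.tendsto.comp hη
      have e : x 1 / Real.sqrt (x 1 ^ 2 + 0 ^ 2) - 1 = 0 := by
        rw [zero_pow two_ne_zero, add_zero, Real.sqrt_sq hx.le, div_self hx.ne', sub_self]
      rw [e, zero_smul, add_zero] at h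
      exact h
    exact (isBoundedBilinearMap_apply.continuous.tendsto (fderiv ℝ ζ x, f x)).comp
      (h1.prodMk_nhds h2)

/-! ### Existence of the stray field potential -/

theorem TestFun.exists_bound (ζ : TestFun) : ∃ C, ∀ x, ‖ζ x‖ ≤ C :=
  ζ.hasCompactSupport.exists_bound_of_continuous ζ.contDiff.continuous

theorem continuous_trace (s : ℝ) : Continuous fun t : ℝ => (!₂[t, s] : Plane) := by
  refine (PiLp.continuous_toLp 2 _).comp ?_
  refine continuous_pi fun i => ?_
  fin_cases i
  · exact continuous_id
  · exact continuous_const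

theorem integrable_mul_trace {h : ℝ → ℝ} {μ : Measure ℝ} (hi : Integrable h μ) (ζ : TestFun)
    (s : ℝ) : Integrable (fun t => h t * ζ !₂[t, s]) μ := by
  obtain ⟨C, hC⟩ := ζ.exists_bound
  exact hi.mul_bdd (c := C)
    (ζ.contDiff.continuous.comp (continuous_trace s)).aestronglyMeasurable
    (Filter.Eventually.of_forall fun t => hC _)

theorem fold_trace {η : ℝ} (hη : 0 < η) (t : ℝ) : fold η !₂[t, 0] = !₂[t, η] := by
  ext i
  fin_cases i
  · simp [fold_apply_zero]
  · simp [fold_apply_one, Real.sqrt_sq hη.le]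

theorem tendsto_integral_trace {h : ℝ → ℝ} {μ : Measure ℝ} (hi : Integrable h μ) (ζ : TestFun)
    {η : ℕ → ℝ} (hη : Filter.Tendsto η Filter.atTop (nhds 0)) :
    Filter.Tendsto (fun n => ∫ t, h t * ζ !₂[t, η n] ∂μ) Filter.atTop
      (nhds (∫ t, h t * ζ !₂[t, 0] ∂μ)) := by
  obtain ⟨C, hC⟩ := ζ.exists_bound
  refine tendsto_integral_of_dominated_convergence (fun t => ‖h t‖ * C)
    (fun n => (integrable_mul_trace hi ζ _).1) (hi.norm.mul_const C) ?_ ?_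
  · intro n
    refine Filter.Eventually.of_forall fun t => ?_
    rw [norm_mul]
    exact mul_le_mul_of_nonneg_left (hC _) (norm_nonneg _)
  · refine Filter.Eventually.of_forall fun t => ?_
    refine Filter.Tendsto.const_mul _ ?_
    have hc : Continuous fun s : ℝ => (!₂[t, s] : Plane) := by
      refine (PiLp.continuous_toLp 2 _).comp (continuous_pi fun i => ?_)
      fin_cases i
      · exact continuous_const
      · exact continuous_id
    exact ((ζ.contDiff.continuous.comp hc).tendsto 0).comp hη

theorem halfPlaneDirichlet_eq (u : HomSobolev) :
    halfPlaneDirichlet u = 2⁻¹ * ENNReal.ofReal (inner ℝ (upperPart (grad u)) (grad u)) := by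
  have hint : Integrable (fun x => inner ℝ (grad u x) (grad u x))
      (volume.restrict upperHalfPlane) :=
    (L2.integrable_inner (𝕜 := ℝ) (grad u) (grad u)).integrableOn
  rw [halfPlaneDirichlet, upperPart, inner_restrict_eq,
    ofReal_integral_eq_lintegral_ofReal hint
      (Filter.Eventually.of_forall fun x => real_inner_self_nonneg)]
  congr 1
  refine lintegral_congr fun x => ?_
  rw [real_inner_self_eq_norm_sq, ENNReal.ofReal_pow (norm_nonneg _), ofReal_norm]

/-- A dual bound for the trace functional yields a stray field potential and a bound for its
Dirichlet energy. -/
theorem exists_isStrayFieldPotential {m : ℝ → Plane} {h : ℝ → ℝ}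
    (hm : ∀ᵐ t ∂(volume.restrict (Ioo (-1 : ℝ) 1)), weakDeriv m t 0 = h t)
    (hi : IntegrableOn h (Ioo (-1) 1)) {M : ℝ} (hM0 : 0 ≤ M)
    (hM : ∀ ζ : TestFun, |2 * ∫ t in Ioo (-1 : ℝ) 1, h t * ζ !₂[t, 0]| ≤ M * ‖ζ‖) :
    ∃ u, IsStrayFieldPotential m u ∧ halfPlaneDirichlet u ≤ ENNReal.ofReal (M ^ 2 / 4) := by
  -- The factor 2 cancels the `½` lost in passing from the plane to the half-plane.
  let F : TestFun →ₗ[ℝ] ℝ :=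
    { toFun := fun ζ => 2 * ∫ t in Ioo (-1 : ℝ) 1, h t * ζ !₂[t, 0]
      map_add' := fun ζ η => by
        rw [← mul_add, ← integral_add (integrable_mul_trace hi ζ 0) (integrable_mul_trace hi η 0)]
        simp only [← mul_add]
        rfl
      map_smul' := fun c ζ => by
        change 2 * ∫ t in Ioo (-1 : ℝ) 1, h t * (c * ζ !₂[t, 0]) = c * (2 * _)
        have e : ∀ t, h t * (c * ζ !₂[t, 0]) = c * (h t * ζ !₂[t, 0]) :=
          fun t => mul_left_comm _ _ _
        simp only [e]
        rw [integral_const_mul, mul_left_comm] }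
  obtain ⟨u, hu1, hu2, hu3⟩ := exists_grad_mem_evenGradients F M hM0 hM
  have heven : ∀ ζ ∈ evenTest, ∫ x in upperHalfPlane, inner ℝ (grad u x) (∇ ζ x) =
      ∫ t in Ioo (-1 : ℝ) 1, h t * ζ !₂[t, 0] := by
    intro ζ hζ
    have h1 : inner ℝ (upperPart (grad u)) (gradTest ζ) =
        ∫ x in upperHalfPlane, inner ℝ (grad u x) (∇ ζ x) := by
      rw [upperPart, inner_restrict_eq]
      refine integral_congr_ae (ae_restrict_of_ae ?_)
      filter_upwards [ζ.memLp_gradient.coeFn_toLp] with x hx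
      exact congrArg _ hx
    rw [← h1, inner_upperPart_of_mem_evenGradients hu1
      (Submodule.le_topologicalClosure _ ⟨ζ, hζ, rfl⟩), hu3 ζ hζ]
    change (2 : ℝ)⁻¹ * (2 * _) = _
    rw [inv_mul_cancel_left₀ two_ne_zero]
  refine ⟨u, fun ζ' h1 h2 => ?_, ?_⟩
  -- A test function that is not even is approximated on the half-plane by its folds, which are even
  -- and whose trace on the axis is the trace of `ζ` at height `η`. Both sides of the equation
  -- converge as `η → 0`.
  · let ζ : TestFun := (⟨ζ', h1, h2⟩ : testSubmodule)
    have hη := tendsto_one_div_add_atTop_nhds_zero_nat (𝕜 := ℝ)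
    have hpos : ∀ n : ℕ, (0 : ℝ) < 1 / ((n : ℝ) + 1) := fun n => by positivity
    have l1 := tendsto_setIntegral_inner_gradient_foldTest ζ (grad u) hpos hη
    have l2 := tendsto_integral_trace hi ζ hη
    refine (tendsto_nhds_unique l1
      (b := ∫ t in Ioo (-1 : ℝ) 1, h t * ζ !₂[t, 0]) ?_).trans ?_
    · refine l2.congr fun n => ?_
      rw [heven _ (foldTest_mem_evenTest ζ (hpos n))]
      simp only [foldTest_apply, fold_trace (hpos n)]
    · refine integral_congr_ae ?_
      filter_upwards [hm] with t ht
      rw [ht]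
      rfl
  -- One factor `½` belongs to the energy, the other is the share of the half-plane in the norm of
  -- an even field.
  · rw [halfPlaneDirichlet_eq, inner_upperPart_of_mem_evenGradients hu1 hu1,
      real_inner_self_eq_norm_sq, show (2⁻¹ : ℝ≥0∞) = ENNReal.ofReal 2⁻¹ by
        rw [ENNReal.ofReal_inv_of_pos (by norm_num)]; simp,
      ← ENNReal.ofReal_mul (by norm_num)]
    refine ENNReal.ofReal_le_ofReal ?_
    have := pow_le_pow_left₀ (norm_nonneg _) hu2 2
    linarith

theorem magnetostaticEnergy_le {m : ℝ → Plane} {u : HomSobolev} (hu : IsStrayFieldPotential m u) :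
    magnetostaticEnergy m ≤ halfPlaneDirichlet u := by
  have hex : ∃ u, IsStrayFieldPotential m u := ⟨u, hu⟩
  rw [magnetostaticEnergy, dif_pos hex]
  exact (halfPlaneDirichlet_eq_of_isStrayFieldPotential hex.choose_spec hu).le

/-! ### Polar coordinates around a boundary point -/

/-- The point with polar coordinates `(r, θ)` around `(a, 0)`. -/
noncomputable def polarAt (a r θ : ℝ) : Plane := !₂[a + r * Real.cos θ, r * Real.sin θ]

theorem continuous_polarAt (a : ℝ) : Continuous fun p : ℝ × ℝ => polarAt a p.1 p.2 := by
  refine (PiLp.continuous_toLp 2 _).comp (continuous_pi fun i => ?_)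
  fin_cases i
  · simp; fun_prop
  · simp; fun_prop

theorem dist_polarAt (a : ℝ) {r : ℝ} (hr : 0 ≤ r) (θ : ℝ) : dist (polarAt a r θ) !₂[a, 0] = r := by
  rw [EuclideanSpace.dist_eq]
  simp only [Fin.sum_univ_two, Real.dist_eq, sq_abs, polarAt]
  have : (a + r * Real.cos θ - a) ^ 2 + (r * Real.sin θ - 0) ^ 2 = r ^ 2 := by
    linear_combination r ^ 2 * Real.cos_sq_add_sin_sq θ
  have e : Real.sqrt ((a + r * Real.cos θ - a) ^ 2 + (r * Real.sin θ - 0) ^ 2) = r := by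
    rw [this, Real.sqrt_sq hr]
  simpa using e

theorem lintegral_polarAt (a : ℝ) {f : Plane → ℝ≥0∞} (hf : Measurable f) :
    ∫⁻ r in Ioi (0 : ℝ), ENNReal.ofReal r * ∫⁻ θ in Ioo (-Real.pi) Real.pi, f (polarAt a r θ) =
      ∫⁻ x, f x := by
  have h1 : ∫⁻ x, f x = ∫⁻ x, f (!₂[a, 0] + x) := (lintegral_add_left_eq_self f _).symm
  have h2 := ((EuclideanSpace.volume_preserving_symm_measurableEquiv_toLp (Fin 2)).symm).lintegral_comp_emb
    (MeasurableEquiv.measurableEmbedding _) (fun x => f (!₂[a, 0] + x))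
  have h3 := ((volume_preserving_finTwoArrow ℝ).symm).lintegral_comp_emb
    (MeasurableEquiv.measurableEmbedding _)
    (fun y => f (!₂[a, 0] + (MeasurableEquiv.toLp 2 (Fin 2 → ℝ)) y))
  have h4 := lintegral_comp_polarCoord_symm (fun p : ℝ × ℝ => f (!₂[a, 0] +
    (MeasurableEquiv.toLp 2 (Fin 2 → ℝ)) (MeasurableEquiv.finTwoArrow.symm p)))
  have e : ∀ p : ℝ × ℝ, !₂[a, 0] + (MeasurableEquiv.toLp 2 (Fin 2 → ℝ))
      (MeasurableEquiv.finTwoArrow.symm (polarCoord.symm p)) = polarAt a p.1 p.2 := by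
    intro p
    ext i
    fin_cases i
    · simp [polarAt, MeasurableEquiv.finTwoArrow]
    · simp [polarAt, MeasurableEquiv.finTwoArrow]
  simp only [e] at h4
  rw [h1, ← h2]
  refine Eq.trans ?_ (h4.trans h3)
  rw [polarCoord_target, Measure.volume_eq_prod, ← Measure.prod_restrict, lintegral_prod]
  · refine lintegral_congr fun r => ?_
    simp only [smul_eq_mul]
    rw [lintegral_const_mul]
    exact hf.comp ((continuous_polarAt a).comp (Continuous.prodMk_right r)).measurable
  · simp only [smul_eq_mul]
    exact ((ENNReal.measurable_ofReal.comp measurable_fst).mul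
      (hf.comp (continuous_polarAt a).measurable)).aemeasurable

theorem hasDerivAt_polarAt (a r θ : ℝ) :
    HasDerivAt (fun θ => polarAt a r θ) (r • !₂[-Real.sin θ, Real.cos θ]) θ := by
  have h : HasDerivAt (fun θ => (![a + r * Real.cos θ, r * Real.sin θ] : Fin 2 → ℝ))
      (r • ![-Real.sin θ, Real.cos θ]) θ := by
    rw [hasDerivAt_pi]
    intro i
    fin_cases i
    · simpa using ((Real.hasDerivAt_cos θ).const_mul r).const_add a
    · simpa using (Real.hasDerivAt_sin θ).const_mul r
  exact ((PiLp.continuousLinearEquiv 2 ℝ (fun _ : Fin 2 => ℝ)).symm :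
    (Fin 2 → ℝ) →L[ℝ] Plane).hasFDerivAt.comp_hasDerivAt θ h

theorem norm_gradient (f : Plane → ℝ) (x : Plane) : ‖∇ f x‖ = ‖fderiv ℝ f x‖ :=
  (InnerProductSpace.toDual ℝ Plane).symm.norm_map _

/-- The upper and the lower half circle of radius `r` both join the two points; adding the two
estimates gives the factor 2 against the full circle. -/
theorem two_mul_abs_sub_le (ζ : TestFun) (a : ℝ) {r : ℝ} (hr : 0 ≤ r) :
    ENNReal.ofReal (2 * |ζ !₂[a + r, 0] - ζ !₂[a - r, 0]|) ≤
      ENNReal.ofReal r * ∫⁻ θ in Ioo (-Real.pi) Real.pi, ‖∇ ζ (polarAt a r θ)‖ₑ := by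
  have hd : ∀ θ, HasDerivAt (fun θ => ζ (polarAt a r θ))
      (fderiv ℝ ζ (polarAt a r θ) (r • !₂[-Real.sin θ, Real.cos θ])) θ := fun θ =>
    (ζ.differentiable (polarAt a r θ)).hasFDerivAt.comp_hasDerivAt θ (hasDerivAt_polarAt a r θ)
  have hcp : Continuous fun θ => polarAt a r θ :=
    (continuous_polarAt a).comp (Continuous.prodMk_right r)
  have hcD : Continuous fun θ => fderiv ℝ ζ (polarAt a r θ) :=
    (ζ.contDiff.continuous_fderiv (by simp)).comp hcp
  have hcv : Continuous fun θ : ℝ => r • (!₂[-Real.sin θ, Real.cos θ] : Plane) := by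
    refine Continuous.const_smul ((PiLp.continuous_toLp 2 _).comp (continuous_pi fun i => ?_)) r
    fin_cases i
    · simp; fun_prop
    · simp; fun_prop
  have hcd := hcD.clm_apply hcv
  have hnv : ∀ θ : ℝ, ‖(!₂[-Real.sin θ, Real.cos θ] : Plane)‖ = 1 := fun θ => by
    simp [EuclideanSpace.norm_eq, Fin.sum_univ_two]
  have hcn : Continuous fun θ => r * ‖∇ ζ (polarAt a r θ)‖ :=
    continuous_const.mul ((continuous_gradient_testFun ζ).comp hcp).norm
  have hb : ∀ θ, |fderiv ℝ ζ (polarAt a r θ) (r • !₂[-Real.sin θ, Real.cos θ])| ≤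
      r * ‖∇ ζ (polarAt a r θ)‖ := fun θ => by
    refine (ContinuousLinearMap.le_opNorm (fderiv ℝ ζ (polarAt a r θ)) _).trans_eq ?_
    rw [norm_smul, hnv, mul_one, Real.norm_of_nonneg hr, norm_gradient, mul_comm]
  have hint : ∀ s t : ℝ, s ≤ t → |ζ (polarAt a r t) - ζ (polarAt a r s)| ≤
      ∫ θ in s..t, r * ‖∇ ζ (polarAt a r θ)‖ := fun s t hst => by
    rw [← intervalIntegral.integral_eq_sub_of_hasDerivAt (fun θ _ => hd θ)
      (hcd.intervalIntegrable _ _)]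
    refine (intervalIntegral.abs_integral_le_integral_abs hst).trans ?_
    exact intervalIntegral.integral_mono hst (hcd.abs.intervalIntegrable _ _)
      (hcn.intervalIntegrable _ _) hb
  have p0 : polarAt a r 0 = !₂[a + r, 0] := by simp [polarAt]
  have p1 : polarAt a r Real.pi = !₂[a - r, 0] := by simp [polarAt, sub_eq_add_neg]
  have p2 : polarAt a r (-Real.pi) = !₂[a - r, 0] := by simp [polarAt, sub_eq_add_neg]
  have i1 := hint 0 Real.pi Real.pi_nonneg
  have i2 := hint (-Real.pi) 0 (neg_nonpos.2 Real.pi_nonneg)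
  rw [p0, p1, abs_sub_comm] at i1
  rw [p0, p2] at i2
  have i3 : 2 * |ζ !₂[a + r, 0] - ζ !₂[a - r, 0]| ≤
      ∫ θ in (-Real.pi)..Real.pi, r * ‖∇ ζ (polarAt a r θ)‖ := by
    rw [← intervalIntegral.integral_add_adjacent_intervals (b := 0)
      (hcn.intervalIntegrable _ _) (hcn.intervalIntegrable _ _)]
    linarith
  refine (ENNReal.ofReal_le_ofReal i3).trans_eq ?_
  rw [intervalIntegral.integral_of_le (by linarith [Real.pi_nonneg]), integral_Ioc_eq_integral_Ioo,
    ofReal_integral_eq_lintegral_ofReal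
      ((hcn.continuousOn.integrableOn_compact isCompact_Icc).mono_set Ioo_subset_Icc_self)
      (Filter.Eventually.of_forall fun θ => by positivity), ← lintegral_const_mul]
  · refine lintegral_congr fun θ => ?_
    rw [ENNReal.ofReal_mul hr, ofReal_norm]
  · exact ((continuous_gradient_testFun ζ).comp hcp).enorm.measurable

theorem integral_odd_mul_trace {ψ : ℝ → ℝ} (hψ : Integrable ψ) (hodd : ∀ s, ψ (-s) = -ψ s)
    (ζ : TestFun) (a : ℝ) : ∫ t, ψ (t - a) * ζ !₂[t, 0] =
      ∫ s in Ioi (0 : ℝ), ψ s * (ζ !₂[a + s, 0] - ζ !₂[a - s, 0]) := by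
  have hi : Integrable fun s => ψ s * ζ !₂[a + s, 0] := by
    have := (integrable_mul_trace (hψ.comp_sub_right a) ζ 0).comp_add_left a
    simpa using this
  have h1 : ∫ t, ψ (t - a) * ζ !₂[t, 0] = ∫ s, ψ s * ζ !₂[a + s, 0] := by
    rw [← integral_add_left_eq_self _ a]
    simp
  have h2 : ∫ s in Iic (0 : ℝ), ψ s * ζ !₂[a + s, 0] =
      ∫ s in Ioi (0 : ℝ), -(ψ s * ζ !₂[a - s, 0]) := by
    have := integral_comp_neg_Ioi 0 (fun s => ψ s * ζ !₂[a + s, 0])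
    rw [neg_zero] at this
    rw [← this]
    simp only [hodd, sub_eq_add_neg, neg_mul]
  have hi' : Integrable fun s => ψ s * ζ !₂[a - s, 0] := by
    have := hi.comp_neg.neg
    simpa [hodd, sub_eq_add_neg, Pi.neg_def] using this
  rw [h1, ← intervalIntegral.integral_Iic_add_Ioi hi.integrableOn hi.integrableOn (b := 0), h2,
    ← integral_add (f := fun s => -(ψ s * ζ !₂[a - s, 0])) hi'.neg.integrableOn hi.integrableOn]
  refine integral_congr_ae (Filter.Eventually.of_forall fun s => ?_)
  ring

/-- Integrating the circle estimate against `|ψ r|` over all radii is integration over the plane in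
polar coordinates, so the weight becomes a radial function. -/
theorem enorm_two_mul_integral_odd_mul_trace_le {ψ : ℝ → ℝ} (hψ : Integrable ψ)
    (hm : Measurable ψ) (hodd : ∀ s, ψ (-s) = -ψ s) (ζ : TestFun) (a : ℝ) :
    ‖2 * ∫ t, ψ (t - a) * ζ !₂[t, 0]‖ₑ ≤
      ∫⁻ x : Plane, ‖ψ (dist x !₂[a, 0])‖ₑ * ‖∇ ζ x‖ₑ := by
  rw [integral_odd_mul_trace hψ hodd, ← integral_const_mul, ← lintegral_polarAt a]
  · refine (enorm_integral_le_lintegral_enorm _).trans ?_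
    refine setLIntegral_mono' measurableSet_Ioi fun r hr => ?_
    have hr : 0 ≤ r := le_of_lt hr
    have h1 := two_mul_abs_sub_le ζ a hr
    simp only [dist_polarAt a hr]
    rw [lintegral_const_mul, mul_left_comm, mul_left_comm (ENNReal.ofReal r), enorm_mul]
    · refine mul_le_mul_right (le_of_eq_of_le ?_ h1) _
      rw [Real.enorm_eq_ofReal_abs, abs_mul, abs_two]
    · exact ((continuous_gradient_testFun ζ).comp
        ((continuous_polarAt a).comp (Continuous.prodMk_right r))).enorm.measurable
  · exact (hm.comp (by fun_prop)).enorm.mul (continuous_gradient_testFun ζ).enorm.measurable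

theorem lintegral_radial (a : ℝ) {ψ : ℝ → ℝ} (hm : Measurable ψ) :
    ∫⁻ x : Plane, ‖ψ (dist x !₂[a, 0])‖ₑ ^ 2 =
      ENNReal.ofReal (2 * Real.pi) * ∫⁻ r in Ioi (0 : ℝ), ENNReal.ofReal r * ‖ψ r‖ₑ ^ 2 := by
  have hmeas : Measurable fun x : Plane => ‖ψ (dist x !₂[a, 0])‖ₑ ^ 2 :=
    (hm.comp (by fun_prop)).enorm.pow_const 2
  rw [← lintegral_polarAt a hmeas, ← lintegral_const_mul]
  · refine setLIntegral_congr_fun measurableSet_Ioi fun r hr => ?_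
    simp only [dist_polarAt a (le_of_lt hr)]
    rw [setLIntegral_const, Real.volume_Ioo, show Real.pi - -Real.pi = 2 * Real.pi by ring]
    ring
  · exact ENNReal.measurable_ofReal.mul (hm.enorm.pow_const 2)

theorem sum_sq_eq_of_pairwise {ι : Type*} [Fintype ι] (f : ι → ℝ≥0∞)
    (hf : ∀ i j, i ≠ j → f i = 0 ∨ f j = 0) : (∑ i, f i) ^ 2 = ∑ i, f i ^ 2 := by
  by_cases h : ∃ i, f i ≠ 0
  · obtain ⟨i, hi⟩ := h
    have h0 : ∀ j, j ≠ i → f j = 0 := fun j hj => (hf j i hj).resolve_right hi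
    rw [Fintype.sum_eq_single i h0, Fintype.sum_eq_single i fun j hj => by simp [h0 j hj]]
  · push Not at h
    simp [h]

theorem TestFun.enorm_eq (ζ : TestFun) :
    ENNReal.ofReal ‖ζ‖ = (∫⁻ x, ‖∇ ζ x‖ₑ ^ (2 : ℝ)) ^ (1 / 2 : ℝ) := by
  rw [← norm_gradTest]
  change ENNReal.ofReal ‖ζ.memLp_gradient.toLp‖ = _
  rw [Lp.norm_toLp, ENNReal.ofReal_toReal ζ.memLp_gradient.2.ne,
    eLpNorm_eq_lintegral_rpow_enorm_toReal (by norm_num) (by norm_num)]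
  norm_num

/-- The trace functional of a superposition of odd profiles with disjoint supports. -/
theorem abs_two_mul_integral_sum_le {ι : Type*} [Fintype ι] {ψ : ℝ → ℝ} (hψ : Integrable ψ)
    (hm : Measurable ψ) (hodd : ∀ s, ψ (-s) = -ψ s) {R : ℝ} (hsupp : ∀ s, R ≤ |s| → ψ s = 0)
    {a : ι → ℝ} (ha : ∀ i j, i ≠ j → 2 * R ≤ |a i - a j|) (b : ι → ℝ) {Q : ℝ} (hQ0 : 0 ≤ Q)
    (hQ : ∫⁻ r in Ioi (0 : ℝ), ENNReal.ofReal r * ‖ψ r‖ₑ ^ 2 ≤ ENNReal.ofReal Q) (ζ : TestFun) :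
    |2 * ∫ t, (∑ i, b i * ψ (t - a i)) * ζ !₂[t, 0]| ≤
      Real.sqrt (2 * Real.pi * Q * ∑ i, b i ^ 2) * ‖ζ‖ := by
  have hmi : ∀ i, Measurable fun x : Plane => ‖b i‖ₑ * ‖ψ (dist x !₂[a i, 0])‖ₑ := fun i =>
    (hm.comp (by fun_prop)).enorm.const_mul _
  have h1 : 2 * ∫ t, (∑ i, b i * ψ (t - a i)) * ζ !₂[t, 0] =
      ∑ i, b i * (2 * ∫ t, ψ (t - a i) * ζ !₂[t, 0]) := by
    simp only [Finset.sum_mul, mul_assoc]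
    rw [integral_finsetSum]
    · rw [Finset.mul_sum]
      refine Finset.sum_congr rfl fun i _ => ?_
      rw [integral_const_mul, mul_left_comm]
    · exact fun i _ => (integrable_mul_trace (hψ.comp_sub_right (a i)) ζ 0).const_mul _
  have h2 : ‖2 * ∫ t, (∑ i, b i * ψ (t - a i)) * ζ !₂[t, 0]‖ₑ ≤
      ∫⁻ x : Plane, (∑ i, ‖b i‖ₑ * ‖ψ (dist x !₂[a i, 0])‖ₑ) * ‖∇ ζ x‖ₑ := by
    rw [h1]
    simp only [Finset.sum_mul]
    rw [lintegral_finsetSum]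
    · refine (enorm_sum_le _ _).trans (Finset.sum_le_sum fun i _ => ?_)
      simp only [mul_assoc]
      rw [enorm_mul, lintegral_const_mul]
      · exact mul_le_mul_right (enorm_two_mul_integral_odd_mul_trace_le hψ hm hodd ζ (a i)) _
      · exact (hm.comp (by fun_prop)).enorm.mul (continuous_gradient_testFun ζ).enorm.measurable
    · exact fun i _ => (hmi i).mul (continuous_gradient_testFun ζ).enorm.measurable
  have h3 := ENNReal.lintegral_mul_le_Lp_mul_Lq volume Real.HolderConjugate.two_two
    (Finset.measurable_sum Finset.univ fun i _ => hmi i).aemeasurable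
    ((continuous_gradient_testFun ζ).enorm.measurable).aemeasurable
  rw [← TestFun.enorm_eq] at h3
  -- Discs of radius `R` about the walls are disjoint, so at each point at most one summand is
  -- nonzero and the square has no cross terms.
  have h4 : ∫⁻ x : Plane, (∑ i, ‖b i‖ₑ * ‖ψ (dist x !₂[a i, 0])‖ₑ) ^ (2 : ℝ) ≤
      ENNReal.ofReal (2 * Real.pi * Q * ∑ i, b i ^ 2) := by
    have e : ∀ x : Plane, (∑ i, ‖b i‖ₑ * ‖ψ (dist x !₂[a i, 0])‖ₑ) ^ (2 : ℝ) =
        ∑ i, ‖b i‖ₑ ^ 2 * ‖ψ (dist x !₂[a i, 0])‖ₑ ^ 2 := by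
      intro x
      rw [ENNReal.rpow_two, sum_sq_eq_of_pairwise]
      · simp only [mul_pow]
      · intro i j hij
        have hd : dist (!₂[a i, 0] : Plane) !₂[a j, 0] = |a i - a j| := by
          rw [EuclideanSpace.dist_eq]
          simp [Fin.sum_univ_two, Real.dist_eq, Real.sqrt_sq_eq_abs]
        have ht := dist_triangle_left (!₂[a i, 0] : Plane) !₂[a j, 0] x
        rw [hd] at ht
        have hij' := ha i j hij
        rcases le_total R (dist x !₂[a i, 0]) with h | h
        · left
          rw [hsupp _ (h.trans (le_abs_self _))]; simp
        · right
          rw [hsupp _ ((by linarith : R ≤ dist x !₂[a j, 0]).trans (le_abs_self _))]; simp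
    simp only [e]
    rw [lintegral_finsetSum]
    · rw [Finset.mul_sum, ENNReal.ofReal_sum_of_nonneg
        fun i _ => mul_nonneg (by positivity) (sq_nonneg _)]
      refine Finset.sum_le_sum fun i _ => ?_
      rw [lintegral_const_mul, lintegral_radial _ hm, mul_comm (2 * Real.pi * Q),
        ENNReal.ofReal_mul (sq_nonneg _), ENNReal.ofReal_mul (q := Q) (by positivity)]
      · rw [Real.enorm_eq_ofReal_abs, ← ENNReal.ofReal_pow (abs_nonneg _), sq_abs]
        gcongr
      · exact (hm.comp (by fun_prop)).enorm.pow_const 2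
    · exact fun i _ => ((hm.comp (by fun_prop)).enorm.pow_const 2).const_mul _
  have h5 : ‖2 * ∫ t, (∑ i, b i * ψ (t - a i)) * ζ !₂[t, 0]‖ₑ ≤
      ENNReal.ofReal (Real.sqrt (2 * Real.pi * Q * ∑ i, b i ^ 2) * ‖ζ‖) := by
    refine h2.trans (h3.trans ?_)
    have hnn : 0 ≤ 2 * Real.pi * Q * ∑ i, b i ^ 2 :=
      mul_nonneg (by positivity) (Finset.sum_nonneg fun i _ => sq_nonneg _)
    rw [ENNReal.ofReal_mul (Real.sqrt_nonneg _), Real.sqrt_eq_rpow,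
      ← ENNReal.ofReal_rpow_of_nonneg hnn (by norm_num)]
    gcongr
  rw [Real.enorm_eq_ofReal_abs] at h5
  exact (ENNReal.ofReal_le_ofReal_iff (by positivity)).1 h5

/-! ### The logarithmic wall profile -/

/-- The logarithmic factor `log (1 + R² / δ²)`. -/
noncomputable def wallLog (R δ : ℝ) : ℝ := Real.log (1 + R ^ 2 / δ ^ 2)

/-- The logarithmic profile of a Néel wall with core width `δ` and tails of length `R`. -/
noncomputable def wallProfile (R δ x : ℝ) : ℝ := max 0 (1 - wallLog x δ / wallLog R δ)

/-- The derivative of `wallProfile`. -/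
noncomputable def wallSlope (R δ x : ℝ) : ℝ :=
  if |x| < R then -(2 * x / (x ^ 2 + δ ^ 2)) / wallLog R δ else 0

section profile

variable {R δ : ℝ}

theorem wallLog_nonneg (x δ : ℝ) : 0 ≤ wallLog x δ :=
  Real.log_nonneg (le_add_of_nonneg_right (by positivity))

theorem wallLog_pos {x : ℝ} (hx : x ≠ 0) (hδ : 0 < δ) : 0 < wallLog x δ :=
  Real.log_pos (lt_add_of_pos_right _ (by positivity))

theorem wallLog_mono {x y : ℝ} (h : |x| ≤ |y|) (δ : ℝ) : wallLog x δ ≤ wallLog y δ := by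
  have := sq_le_sq.2 h
  unfold wallLog
  gcongr

theorem continuous_wallLog (δ : ℝ) : Continuous fun x => wallLog x δ := by
  unfold wallLog
  exact Continuous.log (by fun_prop) fun x => by positivity

theorem hasDerivAt_wallLog (hδ : 0 < δ) (x : ℝ) :
    HasDerivAt (fun x => wallLog x δ) (2 * x / (x ^ 2 + δ ^ 2)) x := by
  have h := (((hasDerivAt_pow 2 x).div_const (δ ^ 2)).const_add 1).log
    (by positivity : (1 : ℝ) + x ^ 2 / δ ^ 2 ≠ 0)
  refine h.congr_deriv ?_
  have : x ^ 2 + δ ^ 2 ≠ 0 := by positivity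
  simp
  field_simp
  ring

theorem sq_div_le_wallLog (hδ : 0 < δ) (x : ℝ) : x ^ 2 / (x ^ 2 + δ ^ 2) ≤ wallLog x δ := by
  refine le_of_eq_of_le ?_ (Real.one_sub_inv_le_log_of_pos
    (by positivity : (0 : ℝ) < 1 + x ^ 2 / δ ^ 2))
  have : x ^ 2 + δ ^ 2 ≠ 0 := by positivity
  have : δ ^ 2 + x ^ 2 ≠ 0 := by positivity
  field_simp
  ring

theorem wallProfile_of_abs_le (hR : 0 < R) {x : ℝ} (hx : |x| ≤ R) :
    wallProfile R δ x = 1 - wallLog x δ / wallLog R δ := by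
  refine max_eq_right (sub_nonneg.2 (div_le_one_of_le₀ ?_ (wallLog_nonneg _ _)))
  exact wallLog_mono (by rwa [abs_of_pos hR]) δ

theorem wallProfile_of_le_abs (hR : 0 < R) (hδ : 0 < δ) {x : ℝ} (hx : R ≤ |x|) :
    wallProfile R δ x = 0 := by
  refine max_eq_left (sub_nonpos.2 ((one_le_div (wallLog_pos hR.ne' hδ)).2 ?_))
  exact wallLog_mono (by rwa [abs_of_pos hR]) δ

theorem wallProfile_zero (R δ : ℝ) : wallProfile R δ 0 = 1 := by
  simp [wallProfile, wallLog]

theorem wallProfile_nonneg (R δ x : ℝ) : 0 ≤ wallProfile R δ x := le_max_left _ _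

theorem wallProfile_le_one (R δ x : ℝ) : wallProfile R δ x ≤ 1 :=
  max_le zero_le_one (sub_le_self _ (div_nonneg (wallLog_nonneg _ _) (wallLog_nonneg _ _)))

theorem wallProfile_lt_one (hR : 0 < R) (hδ : 0 < δ) {x : ℝ} (hx : x ≠ 0) :
    wallProfile R δ x < 1 :=
  max_lt zero_lt_one (sub_lt_self _ (div_pos (wallLog_pos hx hδ) (wallLog_pos hR.ne' hδ)))

theorem continuous_wallProfile (R δ : ℝ) : Continuous (wallProfile R δ) :=
  continuous_const.max (continuous_const.sub ((continuous_wallLog δ).div_const _))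

theorem wallSlope_of_le_abs {x : ℝ} (hx : R ≤ |x|) : wallSlope R δ x = 0 := if_neg hx.not_gt

theorem wallSlope_neg (R δ x : ℝ) : wallSlope R δ (-x) = -wallSlope R δ x := by
  unfold wallSlope
  rw [abs_neg]
  split_ifs
  · ring
  · simp

theorem hasDerivAt_wallProfile (hR : 0 < R) (hδ : 0 < δ) {x : ℝ} (hx : |x| ≠ R) :
    HasDerivAt (wallProfile R δ) (wallSlope R δ x) x := by
  rcases lt_or_gt_of_ne hx with h | h
  · rw [wallSlope, if_pos h]
    have h1 := ((hasDerivAt_wallLog hδ x).div_const (wallLog R δ)).const_sub 1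
    rw [neg_div]
    refine h1.congr_of_eventuallyEq ?_
    filter_upwards [(isOpen_lt continuous_abs continuous_const).mem_nhds h] with y hy
    exact wallProfile_of_abs_le hR (le_of_lt hy)
  · rw [wallSlope_of_le_abs h.le]
    refine (hasDerivAt_const x (0 : ℝ)).congr_of_eventuallyEq ?_
    filter_upwards [(isOpen_lt continuous_const continuous_abs).mem_nhds h] with y hy
    exact wallProfile_of_le_abs hR hδ (le_of_lt hy)

theorem measurable_wallSlope (R δ : ℝ) : Measurable (wallSlope R δ) := by
  unfold wallSlope
  exact Measurable.ite (measurableSet_lt (by fun_prop) measurable_const) (by fun_prop)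
    measurable_const

/-- The slope vanishes at the wall at the rate needed there: for `|x| < R`, `1 - wallProfile` equals
`wallLog x δ / wallLog R δ`, and `log (1 + s) ≥ s / (1 + s)` bounds this below by a multiple of the
squared slope. -/
theorem wallSlope_sq_le (hR : 0 < R) (hδ : 0 < δ) (x : ℝ) :
    wallSlope R δ x ^ 2 ≤ 4 / wallLog R δ / (x ^ 2 + δ ^ 2) * (1 - wallProfile R δ x) := by
  have hL := wallLog_pos hR.ne' hδ
  have hq : 0 < x ^ 2 + δ ^ 2 := by positivity
  by_cases h : |x| < R
  · rw [wallSlope, if_pos h, wallProfile_of_abs_le hR h.le]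
    have h1 : (-(2 * x / (x ^ 2 + δ ^ 2)) / wallLog R δ) ^ 2 =
        4 / wallLog R δ / (x ^ 2 + δ ^ 2) * (x ^ 2 / (x ^ 2 + δ ^ 2) / wallLog R δ) := by
      field_simp
      ring
    rw [h1, sub_sub_cancel]
    gcongr
    exact sq_div_le_wallLog hδ x
  · rw [wallSlope, if_neg h]
    have := sub_nonneg.2 (wallProfile_le_one R δ x)
    rw [zero_pow two_ne_zero]
    positivity

theorem wallSlope_sq_le_const (hR : 0 < R) (hδ : 0 < δ) (x : ℝ) :
    wallSlope R δ x ^ 2 ≤ 4 / wallLog R δ / δ ^ 2 := by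
  have hL := wallLog_pos hR.ne' hδ
  refine (wallSlope_sq_le hR hδ x).trans ?_
  have h1 : 4 / wallLog R δ / (x ^ 2 + δ ^ 2) ≤ 4 / wallLog R δ / δ ^ 2 := by
    gcongr
    nlinarith [sq_nonneg x]
  have h2 : 1 - wallProfile R δ x ≤ 1 := sub_le_self _ (wallProfile_nonneg R δ x)
  have h3 := sub_nonneg.2 (wallProfile_le_one R δ x)
  calc _ ≤ 4 / wallLog R δ / δ ^ 2 * 1 := mul_le_mul h1 h2 h3 (by positivity)
    _ = _ := mul_one _

theorem integrable_wallSlope (hR : 0 < R) (hδ : 0 < δ) : Integrable (wallSlope R δ) := by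
  have h : IntegrableOn (wallSlope R δ) (Icc (-R) R) := by
    refine Measure.integrableOn_of_bounded (M := Real.sqrt (4 / wallLog R δ / δ ^ 2))
      measure_Icc_lt_top.ne (measurable_wallSlope R δ).aestronglyMeasurable ?_
    refine Filter.Eventually.of_forall fun x => ?_
    exact Real.abs_le_sqrt (wallSlope_sq_le_const hR hδ x)
  refine h.integrable_of_forall_notMem_eq_zero fun x hx => wallSlope_of_le_abs ?_
  rw [mem_Icc, ← abs_le] at hx
  exact (not_le.1 hx).le

/-- On `(0, R)` the integrand is `2 / wallLog R δ ^ 2` times the derivative of `wallLog` times `r² /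
(r² + δ²) ≤ 1`; the derivative integrates to `wallLog R δ`. -/
theorem lintegral_mul_wallSlope_sq_le (hR : 0 < R) (hδ : 0 < δ) :
    ∫⁻ r in Ioi (0 : ℝ), ENNReal.ofReal r * ‖wallSlope R δ r‖ₑ ^ 2 ≤
      ENNReal.ofReal (2 / wallLog R δ) := by
  have hL := wallLog_pos hR.ne' hδ
  have hcont : Continuous fun r : ℝ => 2 / wallLog R δ ^ 2 * (2 * r / (r ^ 2 + δ ^ 2)) :=
    continuous_const.mul (Continuous.div₀ (by fun_prop) (by fun_prop) fun r => by positivity)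
  have hint : ∫ r in (0 : ℝ)..R, 2 / wallLog R δ ^ 2 * (2 * r / (r ^ 2 + δ ^ 2)) =
      2 / wallLog R δ := by
    rw [intervalIntegral.integral_eq_sub_of_hasDerivAt
      (fun r _ => (hasDerivAt_wallLog hδ r).const_mul (2 / wallLog R δ ^ 2))
      (hcont.intervalIntegrable _ _)]
    have : wallLog 0 δ = 0 := by simp [wallLog]
    rw [this]
    field_simp
    ring
  rw [← hint, intervalIntegral.integral_of_le hR.le, ofReal_integral_eq_lintegral_ofReal
    ((hcont.continuousOn.integrableOn_compact isCompact_Icc).mono_set Ioc_subset_Icc_self)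
    ((ae_restrict_iff' measurableSet_Ioc).2 (Filter.Eventually.of_forall fun r hr => by
      have := hr.1.le
      change (0 : ℝ) ≤ _
      positivity)),
    ← lintegral_indicator measurableSet_Ioi, ← lintegral_indicator measurableSet_Ioc]
  refine lintegral_mono fun r => ?_
  by_cases hr0 : 0 < r
  swap
  · rw [indicator_of_notMem (show r ∉ Ioi 0 from hr0)]
    exact zero_le
  rw [indicator_of_mem (show r ∈ Ioi 0 from hr0)]
  by_cases hr1 : r < R
  · rw [indicator_of_mem (show r ∈ Ioc 0 R from ⟨hr0, hr1.le⟩), Real.enorm_eq_ofReal_abs,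
      ← ENNReal.ofReal_pow (abs_nonneg _), sq_abs, ← ENNReal.ofReal_mul hr0.le]
    refine ENNReal.ofReal_le_ofReal ?_
    rw [wallSlope, if_pos (by rwa [abs_of_pos hr0])]
    have hq : 0 < r ^ 2 + δ ^ 2 := by positivity
    have e : r * (-(2 * r / (r ^ 2 + δ ^ 2)) / wallLog R δ) ^ 2 =
        2 / wallLog R δ ^ 2 * (2 * r / (r ^ 2 + δ ^ 2)) * (r ^ 2 / (r ^ 2 + δ ^ 2)) := by
      field_simp
    rw [e]
    refine mul_le_of_le_one_right (by positivity) (div_le_one_of_le₀ ?_ hq.le)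
    nlinarith [sq_nonneg δ]
  · rw [wallSlope_of_le_abs ((not_lt.1 hr1).trans (le_abs_self r))]
    simp

theorem integrable_inv_sq_add_sq (hδ : 0 < δ) (a : ℝ) :
    Integrable fun t => ((t - a) ^ 2 + δ ^ 2)⁻¹ := by
  have h := ((integrable_inv_one_add_sq.comp_div hδ.ne').const_mul (δ ^ 2)⁻¹).comp_sub_right a
  refine h.congr (Filter.Eventually.of_forall fun t => ?_)
  have h1 : (t - a) ^ 2 + δ ^ 2 ≠ 0 := by positivity
  have h2 : δ ^ 2 + (t - a) ^ 2 ≠ 0 := by positivity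
  simp only
  field_simp
  ring

theorem integral_inv_sq_add_sq (hδ : 0 < δ) (a : ℝ) :
    ∫ t, ((t - a) ^ 2 + δ ^ 2)⁻¹ = Real.pi / δ := by
  rw [integral_sub_right_eq_self (fun t => (t ^ 2 + δ ^ 2)⁻¹) a]
  have h := Measure.integral_comp_div (fun x : ℝ => (1 + x ^ 2)⁻¹) δ
  rw [integral_univ_inv_one_add_sq, abs_of_pos hδ, smul_eq_mul] at h
  have e : ∀ t : ℝ, (t ^ 2 + δ ^ 2)⁻¹ = (δ ^ 2)⁻¹ * (1 + (t / δ) ^ 2)⁻¹ := fun t => by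
    have h1 : t ^ 2 + δ ^ 2 ≠ 0 := by positivity
    have h2 : δ ^ 2 + t ^ 2 ≠ 0 := by positivity
    field_simp
    ring
  simp only [e]
  rw [integral_const_mul, h]
  field_simp

end profile

/-! ### The trial magnetisation -/

section trial

variable {ι : Type*} [Fintype ι] (c R δ : ℝ) (a d : ι → ℝ)

/-- The first component of the trial magnetisation. -/
noncomputable def trialFirst (t : ℝ) : ℝ := c + ∑ n, (d n - c) * wallProfile R δ (t - a n)

/-- The derivative of `trialFirst`. -/
noncomputable def trialSlope (t : ℝ) : ℝ := ∑ n, (d n - c) * wallSlope R δ (t - a n)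

/-- The trial magnetisation. -/
noncomputable def trial (t : ℝ) : Plane :=
  !₂[trialFirst c R δ a d t, Real.sqrt (1 - trialFirst c R δ a d t ^ 2)]

/-- The derivative of `trial`. -/
noncomputable def trialDeriv (t : ℝ) : Plane :=
  !₂[trialSlope c R δ a d t, -(trialFirst c R δ a d t * trialSlope c R δ a d t /
    Real.sqrt (1 - trialFirst c R δ a d t ^ 2))]

/-- An upper bound for the exchange energy density of `trial`. -/
noncomputable def trialBound (t : ℝ) : ℝ :=
  ∑ n, 16 / ((1 - c ^ 2) * wallLog R δ) * ((t - a n) ^ 2 + δ ^ 2)⁻¹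

variable {c R δ a d}

/-- The separation `2 * R` leaves at most one wall within distance less than `R` of any point, so
all pointwise estimates reduce to a single profile. -/
theorem trial_cases (hR : 0 < R) (hδ : 0 < δ) (ha : ∀ i j, i ≠ j → 2 * R ≤ |a i - a j|) (t : ℝ) :
    ((∀ n, R ≤ |t - a n|) ∧ trialFirst c R δ a d t = c ∧ trialSlope c R δ a d t = 0) ∨
      ∃ n, trialFirst c R δ a d t = c + (d n - c) * wallProfile R δ (t - a n) ∧
        trialSlope c R δ a d t = (d n - c) * wallSlope R δ (t - a n) := by
  by_cases h : ∃ n, |t - a n| < R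
  · obtain ⟨n, hn⟩ := h
    right
    have h0 : ∀ j, j ≠ n → R ≤ |t - a j| := fun j hj => by
      have h1 := ha j n hj
      have h2 := abs_sub_le (a j) t (a n)
      rw [abs_sub_comm (a j) t] at h2
      linarith
    refine ⟨n, ?_, ?_⟩
    · rw [trialFirst, Fintype.sum_eq_single n]
      intro j hj
      rw [wallProfile_of_le_abs hR hδ (h0 j hj), mul_zero]
    · rw [trialSlope, Fintype.sum_eq_single n]
      intro j hj
      rw [wallSlope_of_le_abs (h0 j hj), mul_zero]
  · push Not at h
    left
    refine ⟨h, ?_, ?_⟩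
    · simp [trialFirst, wallProfile_of_le_abs hR hδ (h _)]
    · simp [trialSlope, wallSlope_of_le_abs (h _)]

/-- This is concavity of `1 - q²` along the segment from `c` to `e = ±1`: the left side interpolates
linearly between the end values `1 - c²` and `0`. The difference is `(1 - e * c)² * p * (1 - p)`. -/
theorem one_sub_sq_mul_le {c e p : ℝ} (hc : c ^ 2 < 1) (he : e = 1 ∨ e = -1) (h0 : 0 ≤ p)
    (h1 : p ≤ 1) : (1 - c ^ 2) * (1 - p) ≤ 1 - (c + (e - c) * p) ^ 2 := by
  obtain ⟨hc1, hc2⟩ := abs_lt.1 ((sq_lt_one_iff_abs_lt_one c).1 hc)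
  have hp := mul_nonneg h0 (sub_nonneg.2 h1)
  rcases he with rfl | rfl
  · nlinarith [mul_nonneg hp (sq_nonneg (1 - c))]
  · nlinarith [mul_nonneg hp (sq_nonneg (1 + c))]

theorem continuous_trialFirst : Continuous (trialFirst c R δ a d) :=
  continuous_const.add (continuous_finsetSum _ fun n _ => continuous_const.mul
    ((continuous_wallProfile R δ).comp (continuous_sub_right (a n))))

theorem measurable_trialSlope : Measurable (trialSlope c R δ a d) :=
  Finset.measurable_sum _ fun n _ =>
    ((measurable_wallSlope R δ).comp (measurable_id.sub_const (a n))).const_mul _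

theorem integrable_trialSlope (hR : 0 < R) (hδ : 0 < δ) : Integrable (trialSlope c R δ a d) :=
  integrable_finsetSum _ fun n _ =>
    ((integrable_wallSlope hR hδ).comp_sub_right (a n)).const_mul _

theorem hasDerivAt_trialFirst (hR : 0 < R) (hδ : 0 < δ) {t : ℝ} (ht : ∀ n, |t - a n| ≠ R) :
    HasDerivAt (trialFirst c R δ a d) (trialSlope c R δ a d t) t :=
  (HasDerivAt.fun_sum fun n _ =>
    (((hasDerivAt_wallProfile hR hδ (ht n)).comp_sub_const t (a n)).const_mul (d n - c))).const_add c

theorem trialBound_nonneg (hc : c ^ 2 < 1) (t : ℝ) : 0 ≤ trialBound c R δ a t :=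
  Finset.sum_nonneg fun n _ => mul_nonneg (div_nonneg (by norm_num)
    (mul_nonneg (sub_nonneg.2 hc.le) (wallLog_nonneg _ _))) (by positivity)

theorem trialFirst_sq_le (hc : c ^ 2 < 1) (hR : 0 < R) (hδ : 0 < δ)
    (ha : ∀ i j, i ≠ j → 2 * R ≤ |a i - a j|) (hd : ∀ n, d n = 1 ∨ d n = -1) (t : ℝ) :
    0 ≤ 1 - trialFirst c R δ a d t ^ 2 := by
  rcases trial_cases (c := c) (d := d) hR hδ ha t with ⟨-, h1, -⟩ | ⟨n, h1, -⟩
  · rw [h1]; linarith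
  · rw [h1]
    refine le_trans ?_ (one_sub_sq_mul_le hc (hd n) (wallProfile_nonneg _ _ _)
      (wallProfile_le_one _ _ _))
    exact mul_nonneg (sub_nonneg.2 hc.le) (sub_nonneg.2 (wallProfile_le_one _ _ _))

theorem trialFirst_sq_lt (hc : c ^ 2 < 1) (hR : 0 < R) (hδ : 0 < δ)
    (ha : ∀ i j, i ≠ j → 2 * R ≤ |a i - a j|) (hd : ∀ n, d n = 1 ∨ d n = -1) {t : ℝ}
    (ht : ∀ n, t ≠ a n) : 0 < 1 - trialFirst c R δ a d t ^ 2 := by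
  rcases trial_cases (c := c) (d := d) hR hδ ha t with ⟨-, h1, -⟩ | ⟨n, h1, -⟩
  · rw [h1]; linarith
  · rw [h1]
    refine lt_of_lt_of_le ?_ (one_sub_sq_mul_le hc (hd n) (wallProfile_nonneg _ _ _)
      (wallProfile_le_one _ _ _))
    exact mul_pos (sub_pos.2 hc) (sub_pos.2 (wallProfile_lt_one hR hδ (sub_ne_zero.2 (ht n))))

theorem trialSlope_sq_le (hc : c ^ 2 < 1) (hR : 0 < R) (hδ : 0 < δ)
    (ha : ∀ i j, i ≠ j → 2 * R ≤ |a i - a j|) (hd : ∀ n, d n = 1 ∨ d n = -1) (t : ℝ) :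
    trialSlope c R δ a d t ^ 2 ≤ trialBound c R δ a t * (1 - trialFirst c R δ a d t ^ 2) := by
  have hnn := trialFirst_sq_le hc hR hδ ha hd t
  rcases trial_cases (c := c) (d := d) hR hδ ha t with ⟨-, -, h2⟩ | ⟨n, h1, h2⟩
  · rw [h2, zero_pow two_ne_zero]
    exact mul_nonneg (trialBound_nonneg hc t) hnn
  · have hL := wallLog_pos hR.ne' hδ
    have hc' := sub_pos.2 hc
    have hq : 0 < (t - a n) ^ 2 + δ ^ 2 := by positivity
    have h3 : 16 / ((1 - c ^ 2) * wallLog R δ) * ((t - a n) ^ 2 + δ ^ 2)⁻¹ ≤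
        trialBound c R δ a t :=
      Finset.single_le_sum (f := fun n => 16 / ((1 - c ^ 2) * wallLog R δ) *
        ((t - a n) ^ 2 + δ ^ 2)⁻¹) (fun i _ => by positivity) (Finset.mem_univ n)
    have h4 := one_sub_sq_mul_le hc (hd n) (wallProfile_nonneg R δ (t - a n))
      (wallProfile_le_one R δ (t - a n))
    have h5 := wallSlope_sq_le hR hδ (t - a n)
    have h6 : (d n - c) ^ 2 ≤ 4 := by
      obtain ⟨hc1, hc2⟩ := abs_lt.1 ((sq_lt_one_iff_abs_lt_one c).1 hc)
      rcases hd n with h | h <;> rw [h] <;> nlinarith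
    refine le_trans ?_ (mul_le_mul_of_nonneg_right h3 hnn)
    rw [h2, h1, mul_pow]
    -- The 16 in `trialBound` is the bound 4 for `(d n - c)²` times the 4 in `wallSlope_sq_le`.
    calc (d n - c) ^ 2 * wallSlope R δ (t - a n) ^ 2
        ≤ 4 * (4 / wallLog R δ / ((t - a n) ^ 2 + δ ^ 2) * (1 - wallProfile R δ (t - a n))) :=
          mul_le_mul h6 h5 (sq_nonneg _) (by norm_num)
      _ = 16 / ((1 - c ^ 2) * wallLog R δ) * ((t - a n) ^ 2 + δ ^ 2)⁻¹ *
          ((1 - c ^ 2) * (1 - wallProfile R δ (t - a n))) := by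
          field_simp
          ring
      _ ≤ _ := mul_le_mul_of_nonneg_left h4 (by positivity)

theorem norm_trialDeriv_sq_le (hc : c ^ 2 < 1) (hR : 0 < R) (hδ : 0 < δ)
    (ha : ∀ i j, i ≠ j → 2 * R ≤ |a i - a j|) (hd : ∀ n, d n = 1 ∨ d n = -1) (t : ℝ) :
    ‖trialDeriv c R δ a d t‖ ^ 2 ≤ trialBound c R δ a t := by
  have h0 := trialFirst_sq_le hc hR hδ ha hd t
  have h1 := trialSlope_sq_le hc hR hδ ha hd t
  have h2 := trialBound_nonneg (R := R) (δ := δ) (a := a) hc t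
  rw [EuclideanSpace.norm_sq_eq]
  simp only [trialDeriv, Fin.sum_univ_two, Real.norm_eq_abs, sq_abs]
  change trialSlope c R δ a d t ^ 2 + (-(trialFirst c R δ a d t * trialSlope c R δ a d t /
    Real.sqrt (1 - trialFirst c R δ a d t ^ 2))) ^ 2 ≤ _
  rw [neg_sq, div_pow, Real.sq_sqrt h0]
  -- Where the first component is `±1` the quotient in `trialDeriv` is a division by zero with value
  -- `0`, and `trialSlope_sq_le` forces the slope to vanish. Elsewhere the sum of squares is `m₁'² /
  -- (1 - m₁²)`.
  rcases h0.eq_or_lt with h | h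
  · rw [← h, div_zero, add_zero]
    rw [← h, mul_zero] at h1
    exact h1.trans h2
  · have e : trialSlope c R δ a d t ^ 2 + (trialFirst c R δ a d t * trialSlope c R δ a d t) ^ 2 /
        (1 - trialFirst c R δ a d t ^ 2) =
        trialSlope c R δ a d t ^ 2 / (1 - trialFirst c R δ a d t ^ 2) := by
      field_simp
      ring
    rw [e, div_le_iff₀ h]
    exact h1

theorem trialBound_le (hc : c ^ 2 < 1) (hδ : 0 < δ) (t : ℝ) :
    trialBound c R δ a t ≤ ∑ _n : ι, 16 / ((1 - c ^ 2) * wallLog R δ) * (δ ^ 2)⁻¹ := by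
  refine Finset.sum_le_sum fun n _ => mul_le_mul_of_nonneg_left ?_
    (div_nonneg (by norm_num) (mul_nonneg (sub_nonneg.2 hc.le) (wallLog_nonneg _ _)))
  exact inv_anti₀ (by positivity) (le_add_of_nonneg_left (sq_nonneg _))

theorem measurable_trialDeriv : Measurable (trialDeriv c R δ a d) := by
  have h1 := measurable_trialSlope (c := c) (R := R) (δ := δ) (a := a) (d := d)
  have h2 := (continuous_trialFirst (c := c) (R := R) (δ := δ) (a := a) (d := d)).measurable
  refine (PiLp.continuous_toLp 2 _).measurable.comp (measurable_pi_lambda _ fun i => ?_)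
  fin_cases i
  · exact h1
  · exact ((h2.mul h1).div (measurable_const.sub (h2.pow_const 2)).sqrt).neg

theorem memLp_trialDeriv (hc : c ^ 2 < 1) (hR : 0 < R) (hδ : 0 < δ)
    (ha : ∀ i j, i ≠ j → 2 * R ≤ |a i - a j|) (hd : ∀ n, d n = 1 ∨ d n = -1) (p : ℝ≥0∞) :
    MemLp (trialDeriv c R δ a d) p (volume.restrict (Icc (-1 : ℝ) 1)) := by
  refine MemLp.of_bound measurable_trialDeriv.aestronglyMeasurable
    (Real.sqrt (∑ _n : ι, 16 / ((1 - c ^ 2) * wallLog R δ) * (δ ^ 2)⁻¹))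
    (Filter.Eventually.of_forall fun t => Real.le_sqrt_of_sq_le ?_)
  exact (norm_trialDeriv_sq_le hc hR hδ ha hd t).trans (trialBound_le hc hδ t)

theorem continuous_trial : Continuous (trial c R δ a d) := by
  refine (PiLp.continuous_toLp 2 _).comp (continuous_pi fun i => ?_)
  fin_cases i
  · exact continuous_trialFirst
  · exact (continuous_const.sub (continuous_trialFirst.pow 2)).sqrt

theorem isWeakDeriv_trial (hc : c ^ 2 < 1) (hR : 0 < R) (hδ : 0 < δ)
    (ha : ∀ i j, i ≠ j → 2 * R ≤ |a i - a j|) (hd : ∀ n, d n = 1 ∨ d n = -1) :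
    IsWeakDeriv (trial c R δ a d) (trialDeriv c R δ a d) := by
  -- At `a n` the square root degenerates, and at `a n ± R` the profile has a kink; elsewhere
  -- `trial` is differentiable.
  refine isWeakDeriv_of_hasDerivAt (s := range a ∪ (range (fun n => a n + R) ∪
      range (fun n => a n - R)))
    ((countable_range _).union ((countable_range _).union (countable_range _)))
    continuous_trial (fun t ht => ?_) ?_
  · simp only [mem_union, mem_range, not_or, not_exists] at ht
    obtain ⟨h1, h2, h3⟩ := ht
    have h4 := hasDerivAt_trialFirst (c := c) (d := d) hR hδ (t := t) (a := a) fun n hn => by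
      rcases (abs_eq hR.le).1 hn with h | h
      · exact h2 n (by linarith)
      · exact h3 n (by linarith)
    have h5 := trialFirst_sq_lt hc hR hδ ha hd (t := t) fun n hn => h1 n hn.symm
    have h6 := ((h4.pow 2).const_sub 1).sqrt h5.ne'
    have h : HasDerivAt (fun t => (![trialFirst c R δ a d t,
        Real.sqrt (1 - trialFirst c R δ a d t ^ 2)] : Fin 2 → ℝ))
        ![trialSlope c R δ a d t, -(trialFirst c R δ a d t * trialSlope c R δ a d t /
          Real.sqrt (1 - trialFirst c R δ a d t ^ 2))] t := by
      rw [hasDerivAt_pi]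
      intro i
      fin_cases i
      · exact h4
      · refine h6.congr_deriv ?_
        have := (Real.sqrt_pos.2 h5).ne'
        simp
        field_simp
    exact ((PiLp.continuousLinearEquiv 2 ℝ (fun _ : Fin 2 => ℝ)).symm :
      (Fin 2 → ℝ) →L[ℝ] Plane).hasFDerivAt.comp_hasDerivAt t h
  · exact memLp_one_iff_integrable.1 (memLp_trialDeriv hc hR hδ ha hd 1)

theorem norm_trial (hc : c ^ 2 < 1) (hR : 0 < R) (hδ : 0 < δ)
    (ha : ∀ i j, i ≠ j → 2 * R ≤ |a i - a j|) (hd : ∀ n, d n = 1 ∨ d n = -1) (t : ℝ) :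
    ‖trial c R δ a d t‖ = 1 := by
  rw [← sq_eq_sq₀ (norm_nonneg _) zero_le_one, EuclideanSpace.norm_sq_eq]
  simp [trial, Fin.sum_univ_two, Real.sq_sqrt (trialFirst_sq_le hc hR hδ ha hd t)]

theorem trialFirst_wall (hR : 0 < R) (hδ : 0 < δ) (ha : ∀ i j, i ≠ j → 2 * R ≤ |a i - a j|)
    (n : ι) : trialFirst c R δ a d (a n) = d n := by
  rw [trialFirst, Fintype.sum_eq_single n]
  · rw [sub_self, wallProfile_zero]; ring
  · intro j hj
    rw [wallProfile_of_le_abs hR hδ, mul_zero]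
    have := ha n j hj.symm
    linarith

theorem trialFirst_far (hR : 0 < R) (hδ : 0 < δ) {t : ℝ} (ht : ∀ n, R ≤ |t - a n|) :
    trialFirst c R δ a d t = c := by
  simp [trialFirst, wallProfile_of_le_abs hR hδ (ht _)]

theorem trialSlope_far {t : ℝ} (ht : ∀ n, R ≤ |t - a n|) : trialSlope c R δ a d t = 0 := by
  simp [trialSlope, wallSlope_of_le_abs (ht _)]

theorem le_abs_sub_of_notMem_Ioo {x : ℝ} (hx : -1 + R ≤ x ∧ x ≤ 1 - R) {t : ℝ}
    (ht : t ∉ Ioo (-1 : ℝ) 1) : R ≤ |t - x| := by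
  rw [mem_Ioo, not_and_or, not_lt, not_lt] at ht
  rcases ht with h | h
  · rw [abs_sub_comm]
    exact le_trans (by linarith) (le_abs_self _)
  · exact le_trans (by linarith) (le_abs_self _)

theorem lintegral_weakDeriv_trial_le (hc : c ^ 2 < 1) (hR : 0 < R) (hδ : 0 < δ)
    (ha : ∀ i j, i ≠ j → 2 * R ≤ |a i - a j|) (hd : ∀ n, d n = 1 ∨ d n = -1) :
    ∫⁻ t in Ioo (-1 : ℝ) 1, ‖weakDeriv (trial c R δ a d) t‖ₑ ^ 2 ≤
      ENNReal.ofReal (Fintype.card ι * (16 / ((1 - c ^ 2) * wallLog R δ) * (Real.pi / δ))) := by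
  have hint : ∫ t, trialBound c R δ a t =
      Fintype.card ι * (16 / ((1 - c ^ 2) * wallLog R δ) * (Real.pi / δ)) := by
    unfold trialBound
    rw [integral_finsetSum _ fun n _ => (integrable_inv_sq_add_sq hδ (a n)).const_mul _]
    simp only [integral_const_mul, integral_inv_sq_add_sq hδ]
    simp
  rw [← hint, ofReal_integral_eq_lintegral_ofReal (f := trialBound c R δ a)
    (integrable_finsetSum _ fun n _ => (integrable_inv_sq_add_sq hδ (a n)).const_mul _)
    (Filter.Eventually.of_forall (trialBound_nonneg hc))]
  refine le_trans (lintegral_mono_ae ?_) (setLIntegral_le_lintegral _ _)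
  filter_upwards [(isWeakDeriv_trial hc hR hδ ha hd).ae_eq_weakDeriv] with t ht
  rw [ht, ← ofReal_norm, ← ENNReal.ofReal_pow (norm_nonneg _)]
  exact ENNReal.ofReal_le_ofReal (norm_trialDeriv_sq_le hc hR hδ ha hd t)

theorem magnetostaticEnergy_trial_le (hc : c ^ 2 < 1) (hR : 0 < R) (hδ : 0 < δ)
    (ha : ∀ i j, i ≠ j → 2 * R ≤ |a i - a j|) (hb : ∀ n, -1 + R ≤ a n ∧ a n ≤ 1 - R)
    (hd : ∀ n, d n = 1 ∨ d n = -1) :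
    magnetostaticEnergy (trial c R δ a d) ≤
      ENNReal.ofReal (Real.pi / wallLog R δ * ∑ n, (d n - c) ^ 2) := by
  have hL := wallLog_pos hR.ne' hδ
  have hS : 0 ≤ ∑ n, (d n - c) ^ 2 := Finset.sum_nonneg fun n _ => sq_nonneg _
  obtain ⟨u, hu1, hu2⟩ := exists_isStrayFieldPotential (m := trial c R δ a d)
    (h := trialSlope c R δ a d)
    (by
      filter_upwards [(isWeakDeriv_trial hc hR hδ ha hd).ae_eq_weakDeriv] with t ht
      rw [ht]
      rfl)
    (integrable_trialSlope hR hδ).integrableOn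
    (Real.sqrt_nonneg (2 * Real.pi * (2 / wallLog R δ) * ∑ n, (d n - c) ^ 2))
    (fun ζ => by
      -- The tails end inside `[-1, 1]`, so the trace integral may be taken over the whole line,
      -- where oddness about each wall can be used.
      rw [setIntegral_eq_integral_of_forall_compl_eq_zero fun t ht => by
        rw [trialSlope_far fun n => le_abs_sub_of_notMem_Ioo (hb n) ht, zero_mul]]
      exact abs_two_mul_integral_sum_le (integrable_wallSlope hR hδ) (measurable_wallSlope R δ)
        (wallSlope_neg R δ) (fun s hs => wallSlope_of_le_abs hs) ha (fun n => d n - c)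
        (by positivity) (lintegral_mul_wallSlope_sq_le hR hδ) ζ)
  refine (magnetostaticEnergy_le hu1).trans (hu2.trans_eq ?_)
  rw [Real.sq_sqrt (by positivity)]
  congr 1
  ring

theorem energy_trial_le (hc : c ^ 2 < 1) (hR : 0 < R) (hδ : 0 < δ)
    (ha : ∀ i j, i ≠ j → 2 * R ≤ |a i - a j|) (hb : ∀ n, -1 + R ≤ a n ∧ a n ≤ 1 - R)
    (hd : ∀ n, d n = 1 ∨ d n = -1) {ε : ℝ} (hε : 0 ≤ ε) :
    energy ε (trial c R δ a d) ≤ ENNReal.ofReal (ε / 2 * (Fintype.card ι *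
      (16 / ((1 - c ^ 2) * wallLog R δ) * (Real.pi / δ))) +
        Real.pi / wallLog R δ * ∑ n, (d n - c) ^ 2) := by
  have hL := wallLog_pos hR.ne' hδ
  have hc' := sub_pos.2 hc
  rw [ENNReal.ofReal_add (by positivity)
    (mul_nonneg (by positivity) (Finset.sum_nonneg fun n _ => sq_nonneg _)),
    ENNReal.ofReal_mul (by positivity)]
  exact add_le_add (mul_le_mul_right (lintegral_weakDeriv_trial_le hc hR hδ ha hd) _)
    (magnetostaticEnergy_trial_le hc hR hδ ha hb hd)

end trial

theorem trial_mem_admissible {α R δ : ℝ} {N : ℕ} {a d : Fin N → ℝ} (hα : Real.cos α ^ 2 < 1)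
    (hR : 0 < R) (hδ : 0 < δ) (ha : ∀ i j, i ≠ j → 2 * R ≤ |a i - a j|)
    (hb : ∀ n, -1 + R ≤ a n ∧ a n ≤ 1 - R) (hd : ∀ n, d n = 1 ∨ d n = -1) :
    trial (Real.cos α) R δ a d ∈ admissible α a d := by
  refine ⟨⟨continuous_trial.continuousOn, fun t _ => norm_trial hα hR hδ ha hd t, _,
    isWeakDeriv_trial hα hR hδ ha hd, ?_⟩, ?_, ?_, fun n => ?_⟩
  · exact (memLp_trialDeriv hα hR hδ ha hd 2).mono_measure
      (Measure.restrict_mono Ioo_subset_Icc_self le_rfl)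
  · exact trialFirst_far hR hδ fun n => le_abs_sub_of_notMem_Ioo (hb n) (by simp)
  · exact trialFirst_far hR hδ fun n => le_abs_sub_of_notMem_Ioo (hb n) (by simp)
  · exact trialFirst_wall hR hδ ha n

/-! ### Separation of the walls and the constants -/

/-- Consecutive gaps control all gaps by monotonicity. The end terms of `rho` are doubled distances
to `±1`, so there the bound is `R` and not `2 * R`. -/
theorem separation_of_le_rho {N : ℕ} [NeZero N] {a : Fin N → ℝ} (ha : a ∈ wallPositions N)
    {R : ℝ} (hR : R ≤ rho a) :
    (∀ i j, i ≠ j → 2 * R ≤ |a i - a j|) ∧ ∀ n, -1 + R ≤ a n ∧ a n ≤ 1 - R := by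
  have hbdd : BddBelow ({2 * a 0 + 2, 2 - 2 * a (Fin.rev 0)} ∪
      {t | ∃ i j : Fin N, (i : ℕ) + 1 = j ∧ t = a j - a i}) := by
    refine ⟨0, ?_⟩
    rintro t ((rfl | rfl) | ⟨i, j, hij, rfl⟩)
    · linarith [(ha.2 0).1]
    · linarith [(ha.2 (Fin.rev 0)).2]
    · exact sub_nonneg.2 (ha.1 (Fin.lt_def.2 (by omega))).le
  have key : ∀ t ∈ ({2 * a 0 + 2, 2 - 2 * a (Fin.rev 0)} ∪
      {t | ∃ i j : Fin N, (i : ℕ) + 1 = j ∧ t = a j - a i} : Set ℝ), 2 * R ≤ t := fun t ht => by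
    have := csInf_le hbdd ht
    unfold rho at hR
    linarith
  have k1 := key _ (Or.inl (Or.inl rfl))
  have k2 := key _ (Or.inl (Or.inr rfl))
  have k3 : ∀ i j : Fin N, i < j → 2 * R ≤ a j - a i := fun i j hij => by
    have hj : (i : ℕ) + 1 ≤ j := hij
    let k : Fin N := ⟨i + 1, hj.trans_lt j.2⟩
    have h1 := key (a k - a i) (Or.inr ⟨i, k, rfl, rfl⟩)
    have h2 := ha.1.monotone (show k ≤ j from hj)
    linarith
  refine ⟨fun i j hij => ?_, fun n => ⟨?_, ?_⟩⟩
  · rcases lt_or_gt_of_ne hij with h | h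
    · rw [abs_sub_comm]
      exact (k3 i j h).trans (le_abs_self _)
    · exact (k3 j i h).trans (le_abs_self _)
  · have := ha.1.monotone (Fin.zero_le n)
    linarith
  · have : n ≤ Fin.rev 0 := by
      rw [Fin.le_def, Fin.val_rev]
      have := n.2
      simp
      omega
    have := ha.1.monotone this
    linarith

/-- Dropping the 1 inside the logarithm gives the sharp leading coefficient, needed for the leading
term; the bound is void when `δ ≥ R`. -/
theorem two_mul_log_le_wallLog {R δ : ℝ} (hR : 0 < R) (hδ : 0 < δ) :
    2 * Real.log (1 / δ) - 2 * Real.log (1 / R) ≤ wallLog R δ := by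
  have e : 2 * Real.log (1 / δ) - 2 * Real.log (1 / R) = Real.log (R ^ 2 / δ ^ 2) := by
    rw [Real.log_div (x := R ^ 2) (by positivity) (by positivity), Real.log_pow, Real.log_pow,
      one_div, one_div, Real.log_inv, Real.log_inv]
    push_cast
    ring
  rw [e]
  exact Real.log_le_log (by positivity) (by linarith)

/-- Bernoulli's inequality `(1 + s) ^ p ≤ 1 + p * s` with `p = R² ≤ 1` and `s = 1 / δ²`. The
coefficient is not sharp, but the bound is useful even for `δ ≥ R` and serves in the error terms. -/
theorem sq_mul_log_le_wallLog {R δ : ℝ} (hR : R ∈ Ioc (0 : ℝ) 1) (hδ : 0 < δ) :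
    2 * R ^ 2 * Real.log (1 / δ) ≤ wallLog R δ := by
  have h0 : 0 ≤ 1 / δ ^ 2 := by positivity
  have h1 : (1 + 1 / δ ^ 2) ^ (R ^ 2) ≤ 1 + R ^ 2 * (1 / δ ^ 2) :=
    rpow_one_add_le_one_add_mul_self (by linarith) (sq_nonneg R)
      (pow_le_one₀ hR.1.le hR.2)
  have h2 : Real.log (1 / δ ^ 2) ≤ Real.log (1 + 1 / δ ^ 2) :=
    Real.log_le_log (by positivity) (by linarith)
  have h3 := Real.log_le_log (by positivity) h1
  rw [Real.log_rpow (by positivity)] at h3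
  have h4 : Real.log (1 / δ ^ 2) = 2 * Real.log (1 / δ) := by
    rw [one_div, one_div, Real.log_inv, Real.log_inv, Real.log_pow]
    push_cast
    ring
  rw [h4] at h2
  have h5 : 1 + R ^ 2 * (1 / δ ^ 2) = 1 + R ^ 2 / δ ^ 2 := by ring
  rw [h5] at h3
  have := mul_le_mul_of_nonneg_left h2 (sq_nonneg R)
  unfold wallLog
  linarith

theorem coreWidth_bounds {ε : ℝ} (hε : ε ∈ Ioc (0 : ℝ) (1 / 2)) :
    0 < coreWidth ε ∧ 0 < Real.log (1 / coreWidth ε) ∧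
      Real.log (1 / coreWidth ε) ≤ 4 * Real.log (1 / ε) ∧ 0 < Real.log (1 / ε) := by
  obtain ⟨h0, h1⟩ := hε
  have h2 : Real.log 2 ≤ Real.log (1 / ε) := Real.log_le_log (by norm_num) (by
    rw [le_div_iff₀ h0]; linarith)
  have h3 := Real.log_two_gt_d9
  have hy : 0 < Real.log (1 / ε) := by linarith
  have hδ : 0 < coreWidth ε := mul_pos h0 hy
  have hlt : Real.log (1 / ε) < 1 / ε := by
    have := Real.log_lt_sub_one_of_pos (x := 1 / ε) (by positivity) (by
      intro h
      rw [h, Real.log_one] at hy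
      exact lt_irrefl _ hy)
    linarith
  refine ⟨hδ, Real.log_pos ?_, ?_, hy⟩
  · rw [lt_div_iff₀ hδ, one_mul, coreWidth]
    calc ε * Real.log (1 / ε) < ε * (1 / ε) := mul_lt_mul_of_pos_left hlt h0
      _ = 1 := by field_simp
  · have e : Real.log (1 / coreWidth ε) =
        Real.log (1 / ε) + Real.log (1 / Real.log (1 / ε)) := by
      rw [← Real.log_mul (by positivity) (by positivity)]
      congr 1
      rw [coreWidth]
      field_simp
    have h4 := Real.log_le_sub_one_of_pos (x := 1 / Real.log (1 / ε)) (by positivity)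
    -- This uses `log (1 / ε) ≥ log 2`, the only place where a lower bound on the logarithm away
    -- from zero matters.
    have h5 : 1 / Real.log (1 / ε) ≤ 1 + 3 * Real.log (1 / ε) := by
      rw [div_le_iff₀ hy]
      nlinarith
    rw [e]
    linarith

end NeelWalls


theorem mainTheorem7 (α : ℝ) (hα : α ∈ Set.Ioo 0 Real.pi) (N : ℕ) [NeZero N]
    (R : ℝ) (hR : R ∈ Set.Ioc (0 : ℝ) 1) :
    ∃ C₀ : ℝ, 0 < C₀ ∧
      ∀ ε ∈ Set.Ioc (0 : ℝ) (1 / 2),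
      ∀ a ∈ NeelWalls.wallPositions N, R ≤ NeelWalls.rho a →
      ∀ d : Fin N → ℝ, (∀ n, d n = 1 ∨ d n = -1) →
        (⨅ m ∈ NeelWalls.admissible α a d, NeelWalls.energy ε m) ≤
          ENNReal.ofReal
            (Real.pi / (2 * Real.log (1 / NeelWalls.coreWidth ε)) *
                (∑ n, (d n - Real.cos α) ^ 2) +
              C₀ / Real.log (1 / NeelWalls.coreWidth ε) ^ 2) := by
  obtain ⟨hα0, hα1⟩ := hα
  have hc : Real.cos α ^ 2 < 1 := by
    have := Real.sin_pos_of_pos_of_lt_pi hα0 hα1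
    nlinarith [Real.sin_sq_add_cos_sq α]
  have hc' := sub_pos.2 hc
  have hR0 := hR.1
  have hN : (0 : ℝ) < N := Nat.cast_pos.2 (NeZero.pos N)
  have hk : 0 ≤ Real.log (1 / R) := Real.log_nonneg (by rw [le_div_iff₀ hR0]; linarith [hR.2])
  have hπ := Real.pi_pos
  -- The first summand pays for the exchange energy, the second for replacing `wallLog` by `2 log (1
  -- / δ)` in the stray field energy; the latter vanishes for `R = 1`.
  refine ⟨16 * Real.pi * N / ((1 - Real.cos α ^ 2) * R ^ 2) +
    2 * Real.pi * N * Real.log (1 / R) / R ^ 2, by positivity, ?_⟩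
  intro ε hε a ha hRa d hd
  obtain ⟨hδ, hl, hly, hy⟩ := NeelWalls.coreWidth_bounds hε
  obtain ⟨hsep, hb⟩ := NeelWalls.separation_of_le_rho ha hRa
  refine (iInf₂_le _ (NeelWalls.trial_mem_admissible hc hR0 hδ hsep hb hd)).trans ?_
  refine (NeelWalls.energy_trial_le hc hR0 hδ hsep hb hd hε.1.le).trans ?_
  refine ENNReal.ofReal_le_ofReal ?_
  have hL1 := NeelWalls.two_mul_log_le_wallLog hR0 hδ
  have hL2 := NeelWalls.sq_mul_log_le_wallLog hR hδ
  have hL := NeelWalls.wallLog_pos hR0.ne' hδ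
  have hS0 : 0 ≤ ∑ n, (d n - Real.cos α) ^ 2 := Finset.sum_nonneg fun n _ => sq_nonneg _
  have hS : ∑ n, (d n - Real.cos α) ^ 2 ≤ 4 * N := by
    refine (Finset.sum_le_sum (g := fun _ => (4 : ℝ)) fun n _ => ?_).trans_eq ?_
    · have h1 := Real.cos_le_one α
      have h2 := Real.neg_one_le_cos α
      rcases hd n with h | h <;> rw [h] <;> nlinarith
    · simp [mul_comm]
  rw [Fintype.card_fin]
  have hε0 : ε ≠ 0 := hε.1.ne'
  have hcore : NeelWalls.coreWidth ε = ε * Real.log (1 / ε) := rfl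
  set l := Real.log (1 / NeelWalls.coreWidth ε)
  set y := Real.log (1 / ε)
  set k := Real.log (1 / R)
  set S := ∑ n, (d n - Real.cos α) ^ 2
  set L := NeelWalls.wallLog R (NeelWalls.coreWidth ε)
  -- With `δ = ε * y` the factor `ε` cancels and `1 / (L * y)` remains, where `L ≥ 2 * R² * l` and
  -- `y ≥ l / 4`.
  have hexch : ε / 2 * (N * (16 / ((1 - Real.cos α ^ 2) * L) *
      (Real.pi / NeelWalls.coreWidth ε))) ≤
      16 * Real.pi * N / ((1 - Real.cos α ^ 2) * R ^ 2) / l ^ 2 := by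
    have e1 : ε / 2 * (N * (16 / ((1 - Real.cos α ^ 2) * L) *
        (Real.pi / NeelWalls.coreWidth ε))) =
        8 * Real.pi * N / (1 - Real.cos α ^ 2) * (1 / (L * y)) := by
      rw [hcore]
      field_simp
      norm_num
    have e2 : 16 * Real.pi * N / ((1 - Real.cos α ^ 2) * R ^ 2) / l ^ 2 =
        8 * Real.pi * N / (1 - Real.cos α ^ 2) * (1 / (2 * R ^ 2 * l * (l / 4))) := by
      field_simp
      norm_num
    rw [e1, e2]
    gcongr
    linarith
  have hstray : Real.pi / L * S ≤
      Real.pi / (2 * l) * S + 2 * Real.pi * N * k / R ^ 2 / l ^ 2 := by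
    -- The difference of `1 / L` and `1 / (2 * l)` is second order: its numerator is bounded using
    -- the sharp estimate for `L`, its denominator using the Bernoulli estimate.
    have e1 : Real.pi / L * S = Real.pi / (2 * l) * S + Real.pi * S * ((2 * l - L) / (2 * l * L)) := by
      field_simp
      ring
    have h1 : (2 * l - L) / (2 * l * L) ≤ 2 * k / (2 * l * (2 * R ^ 2 * l)) := by
      gcongr
      linarith
    have h2 : Real.pi * S * ((2 * l - L) / (2 * l * L)) ≤
        Real.pi * (4 * N) * (2 * k / (2 * l * (2 * R ^ 2 * l))) :=
      (mul_le_mul_of_nonneg_left h1 (by positivity)).trans (by gcongr)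
    have e2 : 2 * Real.pi * N * k / R ^ 2 / l ^ 2 =
        Real.pi * (4 * N) * (2 * k / (2 * l * (2 * R ^ 2 * l))) := by
      field_simp
      ring
    rw [e1, e2]
    linarith
  rw [add_div]
  linarith
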